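/- Let $L>0$ with $2L\notin\mathbb N$, let $\Pi=\{(x,y):x\in\mathbb R,\ 0<y<L\}$, and let $$\mathcal D=\begin{pmatrix}0&i\partial_x+\partial_y&0&0\\ i\partial_x-\partial_y&0&0&0\\ 0&0&0&-i\partial_x+\partial_y\\ 0&0&-i\partial_x-\partial_y&0\end{pmatrix}$$ act on $w=(u,v,u',v')$ subject to the armchair boundary conditions $$u-iu'=0,\quad -iv+v'=0\ \text{ at } y=0;\qquad e^{-2\pi iL}u-iu'=0,\quad -ie^{-2\pi iL}v+v'=0\ \text{ at } y=L.\qquad (\mathrm{BC})$$ *Thresholds and parameters.* Put $\omega_0=0$ and $\omega_{k+1}=\min\{|\kappa|:\kappa\in\pi+\tfrac{\pi}{L}\mathbb Z,\ |\kappa|>\omega_k\}$. Fix $N\ge1$, let $\varepsilon\ge0$ be such that $\omega:=\omega_N-\varepsilon>\omega_{N-1}$, and let $\gamma$ satisfy $\sqrt{\omega_N^2-\omega^2}<\gamma<\sqrt{\omega_{N+1}^2-\omega^2}$. (Then the numbers $\lambda$ with $|\operatorname{Im}\lambda|\le\gamma$ and $\lambda^2=\omega^2-\kappa^2$ for some $\kappa\in\pi+\frac{\pi}{L}\mathbb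 Z$ are finitely many real ones and $\pm\lambda_\varepsilon$, where $\lambda_\varepsilon=i\sqrt{\varepsilon}\sqrt{2\omega_N-\varepsilon}$.) Let $\delta\in\mathbb R$, $R_0>0$, and let $\mathcal P$ be a continuous real-valued function on $\overline\Pi$ that vanishes for $|x|>R_0$. *Waves.* Let $\kappa_1<\dots<\kappa_{N-1}$ be the elements of $\pi+\frac{\pi}{L}\mathbb Z$ in $(-\omega,\omega)$, let $\kappa_N$ be the element of $\pi+\frac{\pi}{L}\mathbb Z$ with $|\kappa_N|=\omega_N$, and put $$E(\kappa,\lambda)=e^{i\lambda x}\Big(e^{i\kappa y},\,-\tfrac{\lambda+i\kappa}{\omega}e^{i\kappa y},\,-ie^{-i\kappa y},\,-i\tfrac{\lambda+i\kappa}{\omega}e^{-i\kappa y}\Big).$$ For $j<N$ and $\lambda_j=\sqrt{\omega^2-\kappa_j^2}$ let $\mathbf w_j^{\pm}=\frac{\sqrt{\omega}}{2\sqrt{L\lambda_j}}E(\kappa_j,\pm\lambda_j)$. Let $$\mathbf w_N^{\pm}=\frac{\mathbf w_N^{\varepsilon+}\pm\mathbf w_N^{\varepsilon-}}{2\sqrt{L/\omega}},\qquad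 \mathbf w_N^{\varepsilon+}=\frac{E(\kappa_N,\lambda_\varepsilon)+E(\kappa_N,-\lambda_\varepsilon)}{2},\qquad \mathbf w_N^{\varepsilon-}=\frac{E(\kappa_N,\lambda_\varepsilon)-E(\kappa_N,-\lambda_\varepsilon)}{2\lambda_\varepsilon},$$ where for $\varepsilon=0$ the last expression is replaced by its limit as $\varepsilon\downarrow0$, that is, $i\big(x\,E(\kappa_N,0)+\omega_N^{-1}(0,ie^{i\kappa_Ny},0,-e^{-i\kappa_Ny})\big)$, in which $E(\kappa_N,0)$ is taken at $\omega=\omega_N$. Let $\chi_\pm=\chi_\pm(x)$ be smooth functions with $\chi_+=1,\ \chi_-=0$ for $x>R_0$ and $\chi_+=0,\ \chi_-=1$ for $x<-R_0$, and define the outgoing and incoming waves $$W_k^{\pm}=\chi_\pm\mathbf w_k^{\pm},\qquad V_k^{\mp}=\chi_\pm\mathbf w_k^{\mp},\qquad k=1,\dots,N.$$ *Scattering matrix.* Let $\mathcal H_\gamma^{\pm}$ be the space of all $w$ on $\Pi$ that satisfy (BC) (in the weak sense) and for which $e^{\pm\gamma|x|}w$ and $e^{\pm\gamma|x|}\mathcal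 Dw$ are in $L^2(\Pi)^4$, and let $\ker A_\gamma^-$ be the space of all $w\in\mathcal H_\gamma^-$ with $\mathcal Dw+\delta\mathcal Pw=\omega w$. The augmented scattering matrix $\mathbf S=(\mathbf S_{k\tau}^{j\theta})$, with $k,j\in\{1,\dots,N\}$ and $\tau,\theta\in\{+,-\}$, is defined by the condition that $\ker A_\gamma^-$ has a basis of the form $$z_k^{\tau}=V_k^{\tau}+\sum_{\theta=\pm}\sum_{j=1}^{N}\mathbf S_{k\tau}^{j\theta}W_j^{\theta}+\tilde z_k^{\tau},\qquad \tilde z_k^{\tau}\in\mathcal H_\gamma^{+}.$$ **Proposition.** The augmented scattering matrix is unitary: every matrix $\mathbf S\in\mathbb C^{2N\times2N}$ with this defining property satisfies $\mathbf S\mathbf S^*=\mathbf S^*\mathbf S=I$. -/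

import Mathlib

open MeasureTheory

noncomputable section

namespace Nanoribbon

/-- The values of the wave function `(u, v, u', v')`; the components are numbered `0, 1, 2, 3`. -/
abbrev Spinor : Type := Fin 4 → ℂ

/-- The nanoribbon: points `(x, y)` with `x ∈ ℝ` and `0 < y < L`. -/
def strip (L : ℝ) : Set (ℝ × ℝ) := {p | 0 < p.2 ∧ p.2 < L}

/-- Lebesgue measure on the nanoribbon. -/
def stripMeasure (L : ℝ) : Measure (ℝ × ℝ) := volume.restrict (strip L)

/-- Vector functions on the nanoribbon, modulo equality almost everywhere. -/
abbrev Field (L : ℝ) : Type := (ℝ × ℝ) →ₘ[stripMeasure L] Spinor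

/-- `∂φ/∂x`. -/
def partialX (φ : ℝ × ℝ → Spinor) (p : ℝ × ℝ) : Spinor := fderiv ℝ φ p (1, 0)

/-- `∂φ/∂y`. -/
def partialY (φ : ℝ × ℝ → Spinor) (p : ℝ × ℝ) : Spinor := fderiv ℝ φ p (0, 1)

/-- The Dirac operator `𝒟`, on differentiable functions. -/
def dirac (φ : ℝ × ℝ → Spinor) (p : ℝ × ℝ) : Spinor :=
  ![Complex.I * partialX φ p 1 + partialY φ p 1,
    Complex.I * partialX φ p 0 - partialY φ p 0,
    -Complex.I * partialX φ p 3 + partialY φ p 3,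
    -Complex.I * partialX φ p 2 - partialY φ p 2]

/-- The armchair boundary conditions on the two edges `y = 0` and `y = L`. -/
def ArmchairBC (L : ℝ) (φ : ℝ × ℝ → Spinor) : Prop :=
  ∀ x : ℝ,
    φ (x, 0) 0 - Complex.I * φ (x, 0) 2 = 0 ∧
    -Complex.I * φ (x, 0) 1 + φ (x, 0) 3 = 0 ∧
    Complex.exp (-(2 * Real.pi * L * Complex.I)) * φ (x, L) 0 - Complex.I * φ (x, L) 2 = 0 ∧
    -Complex.I * Complex.exp (-(2 * Real.pi * L * Complex.I)) * φ (x, L) 1 + φ (x, L) 3 = 0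

/-- The Hermitian product of `ℂ⁴`, linear in the first argument. -/
def pairing (a b : Spinor) : ℂ := ∑ i, a i * (starRingEnd ℂ) (b i)

/-- `w` satisfies `𝒟 w = f` in the strip together with the armchair boundary conditions, in the
weak sense: `∫ w · conj (𝒟 φ) = ∫ f · conj φ` for all smooth, compactly supported `φ` (not
necessarily vanishing on the edges) that satisfy the boundary conditions.
Test functions supported inside the strip give the equation in the sense of distributions. Green's
formula, whose boundary terms cancel when both functions satisfy the boundary conditions, shows
that the remaining ones give the boundary conditions for the traces of `w`. -/
def WeakDirac (L : ℝ) (w f : Field L) : Prop :=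
  ∀ φ : ℝ × ℝ → Spinor, ContDiff ℝ ((⊤ : ℕ∞) : WithTop ℕ∞) φ → HasCompactSupport φ → ArmchairBC L φ →
    ∫ p, pairing (w p) (dirac φ p) ∂(stripMeasure L) =
      ∫ p, pairing (f p) (φ p) ∂(stripMeasure L)

/-- The weighted space of all `f` with `e^{σ|x|} f ∈ L²`; for `σ = γ` and `σ = -γ` these are
`𝓛_γ^+` and `𝓛_γ^-`. -/
def weightedL2 (L σ : ℝ) : Set (Field L) :=
  {f | MemLp (fun p : ℝ × ℝ => Real.exp (σ * |p.1|) • f p) 2 (stripMeasure L)}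

/-- The space of all `w` with the boundary conditions such that `w` and `𝒟 w` are square integrable
with the weight `e^{σ|x|}`; for `σ = γ` and `σ = -γ` these are `𝓗_γ^+` and `𝓗_γ^-`. -/
def weightedH (L σ : ℝ) : Set (Field L) :=
  {w | w ∈ weightedL2 L σ ∧ ∃ f ∈ weightedL2 L σ, WeakDirac L w f}

/-- The kernel of `A_γ^- = 𝒟 + δ𝒫 - ω : 𝓗_γ^- → 𝓛_γ^-`. -/
def kerAMinus (L γ ω δ : ℝ) (P : ℝ × ℝ → ℝ) : Set (Field L) :=
  {w | w ∈ weightedH L (-γ) ∧ ∃ f : Field L, WeakDirac L w f ∧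
    ∀ᵐ p ∂(stripMeasure L), f p + (δ * P p) • w p - ω • w p = 0}

/-- The transverse wave numbers `κ = π + π j / L`, `j ∈ ℤ`. -/
def IsTransverse (L κ : ℝ) : Prop := ∃ j : ℤ, κ = Real.pi + Real.pi * j / L

/-- The energy thresholds `ω_1 < ω_2 < …`, preceded by `ω_0 = 0`: the number `ω_{k+1}` is the
smallest `|κ|` that is greater than `ω_k`. -/
def threshold (L : ℝ) : ℕ → ℝ
  | 0 => 0
  | k + 1 => sInf {t : ℝ | (∃ κ : ℝ, IsTransverse L κ ∧ t = |κ|) ∧ threshold L k < t}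

/-- The wave numbers `κ_1, …, κ_N` with `N = n + 1`: the first `N - 1` enumerate in increasing
order the transverse wave numbers in `(-ω, ω)`, and `κ_N = ± ω_N`. -/
structure IsModeFamily (L ω : ℝ) (n : ℕ) (κ : Fin (n + 1) → ℝ) : Prop where
  strictMono : StrictMono fun j : Fin n => κ j.castSucc
  range_eq : (Set.range fun j : Fin n => κ j.castSucc) = {k | IsTransverse L k ∧ |k| < ω}
  isTransverse_last : IsTransverse L (κ (Fin.last n))
  abs_last : |κ (Fin.last n)| = threshold L (n + 1)

/-- The exponential solution with longitudinal wave number `lam` and transverse wave number `κ`,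
where `lam ^ 2 = ω ^ 2 - κ ^ 2`. -/
def expWave (ω κ : ℝ) (lam : ℂ) (p : ℝ × ℝ) : Spinor :=
  Complex.exp (Complex.I * lam * p.1) •
    ![Complex.exp (Complex.I * κ * p.2),
      -((lam + Complex.I * κ) / ω) * Complex.exp (Complex.I * κ * p.2),
      -Complex.I * Complex.exp (-(Complex.I * κ * p.2)),
      -Complex.I * ((lam + Complex.I * κ) / ω) * Complex.exp (-(Complex.I * κ * p.2))]

/-- The sign `τ = ±`, with `true` for `+` and `false` for `-`. -/
def sgn (τ : Bool) : ℝ := if τ then 1 else -1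

/-- The normalised oscillatory waves `𝐰_j^±`, `j < N`, with `λ_j = √(ω² - κ_j²)`. -/
def oscWave (L ω κ : ℝ) (τ : Bool) (p : ℝ × ℝ) : Spinor :=
  (Real.sqrt ω / (2 * Real.sqrt (L * Real.sqrt (ω ^ 2 - κ ^ 2)))) •
    expWave ω κ ((sgn τ * Real.sqrt (ω ^ 2 - κ ^ 2) : ℝ) : ℂ) p

/-- The bounded threshold solution `w_N^0` at the energy `ω_N = |κ|`. -/
def thresholdWave0 (κ : ℝ) (p : ℝ × ℝ) : Spinor :=
  ![Complex.exp (Complex.I * κ * p.2),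
    -Complex.I * Real.sign κ * Complex.exp (Complex.I * κ * p.2),
    -Complex.I * Complex.exp (-(Complex.I * κ * p.2)),
    Real.sign κ * Complex.exp (-(Complex.I * κ * p.2))]

/-- The linearly growing threshold solution `w_N^1` at the energy `ω_N = |κ|`. -/
def thresholdWave1 (κ : ℝ) (p : ℝ × ℝ) : Spinor :=
  p.1 • thresholdWave0 κ p +
    |κ|⁻¹ • ![0, Complex.I * Complex.exp (Complex.I * κ * p.2),
      0, -Complex.exp (-(Complex.I * κ * p.2))]

/-- `|λ_ε| = √ε √(2 ω_N - ε)`. -/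
def rateEps (ωN ε : ℝ) : ℝ := Real.sqrt ε * Real.sqrt (2 * ωN - ε)

/-- The imaginary wave number `λ_ε`. -/
def lamEps (ωN ε : ℝ) : ℂ := Complex.I * rateEps ωN ε

/-- `𝐰_N^{ε+} = (w_N^+ + w_N^-) / 2`. -/
def evenWave (ωN ε κ : ℝ) (p : ℝ × ℝ) : Spinor :=
  (1 / 2 : ℂ) • (expWave (ωN - ε) κ (lamEps ωN ε) p + expWave (ωN - ε) κ (-lamEps ωN ε) p)

/-- `𝐰_N^{ε-} = (w_N^+ - w_N^-) / (2 λ_ε)`, continued analytically to `ε = 0` by `i w_N^1`. -/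
def oddWave (ωN ε κ : ℝ) (p : ℝ × ℝ) : Spinor :=
  if ε = 0 then Complex.I • thresholdWave1 κ p
  else (1 / (2 * lamEps ωN ε)) •
    (expWave (ωN - ε) κ (lamEps ωN ε) p - expWave (ωN - ε) κ (-lamEps ωN ε) p)

/-- The normalised artificial waves `𝐰_N^± = (𝐰_N^{ε+} ± 𝐰_N^{ε-}) / (2 √(L / ω_ε))`. -/
def artificialWave (L ωN ε κ : ℝ) (τ : Bool) (p : ℝ × ℝ) : Spinor :=
  (1 / (2 * Real.sqrt (L / (ωN - ε)))) • (evenWave ωN ε κ p + sgn τ • oddWave ωN ε κ p)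

/-- The waves `𝐰_k^τ`, `k = 1, …, N = n + 1`, at the energy `ω_N - ε`. -/
def wave (L ε : ℝ) (n : ℕ) (κ : Fin (n + 1) → ℝ) (k : Fin (n + 1)) (τ : Bool) :
    ℝ × ℝ → Spinor :=
  if k = Fin.last n then artificialWave L (threshold L (n + 1)) ε (κ k) τ
  else oscWave L (threshold L (n + 1) - ε) (κ k) τ

/-- The cut-off functions `χ_+ = χ true` and `χ_- = χ false`. -/
structure IsCutoffPair (R₀ : ℝ) (χ : Bool → ℝ → ℝ) : Prop where
  smooth : ∀ τ, ContDiff ℝ ((⊤ : ℕ∞) : WithTop ℕ∞) (χ τ)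
  right : ∀ x, R₀ < x → χ true x = 1 ∧ χ false x = 0
  left : ∀ x, x < -R₀ → χ true x = 0 ∧ χ false x = 1

/-- The outgoing waves `W_k^± = χ_± 𝐰_k^±`. -/
def outWave (L ε : ℝ) (n : ℕ) (κ : Fin (n + 1) → ℝ) (χ : Bool → ℝ → ℝ)
    (k : Fin (n + 1)) (τ : Bool) (p : ℝ × ℝ) : Spinor :=
  χ τ p.1 • wave L ε n κ k τ p

/-- The incoming waves `V_k^∓ = χ_± 𝐰_k^∓`. -/
def inWave (L ε : ℝ) (n : ℕ) (κ : Fin (n + 1) → ℝ) (χ : Bool → ℝ → ℝ)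
    (k : Fin (n + 1)) (τ : Bool) (p : ℝ × ℝ) : Spinor :=
  χ (!τ) p.1 • wave L ε n κ k τ p

/-- `S` is the augmented scattering matrix: `ker A_γ^-` has a basis of the form
`z_k^τ = V_k^τ + ∑_{j,θ} S_{kτ}^{jθ} W_j^θ + r_k^τ` with `r_k^τ ∈ 𝓗_γ^+`. The row index of `S` is
`(k, τ)` and the column index is `(j, θ)`. -/
def IsScatteringMatrix (L γ ε δ : ℝ) (P : ℝ × ℝ → ℝ) (n : ℕ) (κ : Fin (n + 1) → ℝ)
    (χ : Bool → ℝ → ℝ)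
    (S : Matrix (Fin (n + 1) × Bool) (Fin (n + 1) × Bool) ℂ) : Prop :=
  ∃ z r : Fin (n + 1) × Bool → Field L,
    LinearIndependent ℂ z ∧
    (Submodule.span ℂ (Set.range z) : Set (Field L)) =
      kerAMinus L γ (threshold L (n + 1) - ε) δ P ∧
    (∀ a, r a ∈ weightedH L γ) ∧
    ∀ a, ∀ᵐ p ∂(stripMeasure L),
      z a p = inWave L ε n κ χ a.1 a.2 p +
        ∑ b, S a b • outWave L ε n κ χ b.1 b.2 p + r a p

end Nanoribbon

end

/-! Unitarity is conservation of current. If `z`, `z'` lie in the kernel, both solve `𝒟z = (ω -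
δ𝒫)z` with the same real potential, so the current `∫ ⟨σz, z'⟩ dy`, with `σ` the symbol of `𝒟` in
the direction of `x`, should be the same through every cross-section. Here it is averaged: `plateau
T` has derivative one bump near `-T` minus one bump near `T`, and the integral of this derivative
against the current vanishes. Write `z = v + r`, with `v` the combination of incoming and outgoing
waves. The cross terms with `r` are integrable, because the weights `e^{±γ|x|}` cancel, and the
bumps move to infinity, so these terms disappear as `T → ∞`. On each side `v` is a fixed combination
of the waves, whose current matrix is diagonal with entries `∓i` (`integral_pairing_symbolX_wave`):
different transverse modes are orthogonal, and within one mode the normalisation does the rest, also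
for the artificial pair at the threshold. Equating the currents at the two ends gives `S S* = I`,
which suffices for a square matrix. The analytic difficulty is that elements of the kernel are only
weak solutions, so Green's formula cannot be read off from traces. It is obtained from
self-adjointness (`integral_pairing_comm_of_weakDiracFn`): `𝒟` is symmetric on test functions, and
`𝒟 ± i` have dense ranges there. For the density, the factor `(𝒟 + c)(𝒟 - c) = 𝒟² + 1`, `c = ±i`,
acts on the transverse mode `κ` as `-∂ₓ² + κ² + 1`. Every transverse coefficient of a function
orthogonal to the range is then a square integrable weak solution of `h'' = (κ² + 1)h`, hence zero,
and the transverse modes are complete. -/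

noncomputable section

/-! ### Abstract criterion for essential self-adjointness -/

/-- If the symmetric operator with graph `T` has `D ± i` with dense ranges, then its adjoint is symmetric. -/
theorem inner_eq_of_mem_adjoint {H : Type*} [NormedAddCommGroup H] [InnerProductSpace ℂ H]
    [CompleteSpace H] (T : Submodule ℂ (H × H))
    (hsymm : ∀ p ∈ T, ∀ q ∈ T, inner ℂ p.1 q.2 = inner ℂ p.2 q.1)
    (hplus : ∀ u : H, (∀ p ∈ T, inner ℂ u (p.2 + Complex.I • p.1) = 0) → u = 0)
    (hminus : ∀ u : H, (∀ p ∈ T, inner ℂ u (p.2 - Complex.I • p.1) = 0) → u = 0)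
    {w g w' g' : H} (h : ∀ p ∈ T, inner ℂ w p.2 = inner ℂ g p.1)
    (h' : ∀ p ∈ T, inner ℂ w' p.2 = inner ℂ g' p.1) :
    inner ℂ w g' = inner ℂ g w' := by
  let e : WithLp 2 (H × H) ≃L[ℂ] H × H := WithLp.prodContinuousLinearEquiv 2 ℂ H H
  let K : Submodule ℂ (WithLp 2 (H × H)) := (T.comap e.toLinearMap).topologicalClosure
  have hK : IsClosed (K : Set (WithLp 2 (H × H))) := Submodule.isClosed_topologicalClosure _
  have : CompleteSpace K := hK.completeSpace_coe
  -- a closed condition that holds on the graph holds on its closure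
  have hclos : ∀ a b : H, (∀ p ∈ T, inner ℂ p.1 a = inner ℂ p.2 b) →
      ∀ p ∈ K, inner ℂ p.fst a = inner ℂ p.snd b := by
    intro a b hab p hp
    have hcl : IsClosed {p : WithLp 2 (H × H) | inner ℂ p.fst a = inner ℂ p.snd b} := by
      refine isClosed_eq ?_ ?_
      · exact ((continuous_fst.comp e.continuous)).inner continuous_const
      · exact ((continuous_snd.comp e.continuous)).inner continuous_const
    exact closure_minimal (s := (T.comap e.toLinearMap : Set (WithLp 2 (H × H))))
      (t := {p : WithLp 2 (H × H) | inner ℂ p.fst a = inner ℂ p.snd b})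
      (fun q hq => hab (e q) hq) hcl hp
  -- The adjoint graph lies in the closure of the graph. The component `y` of `(w, g)` orthogonal to
  -- `K` also satisfies the adjoint relation, by symmetry, and the two relations together say that
  -- `y.fst ± i y.snd` is orthogonal to the range of `D ∓ i`.
  have key : WithLp.toLp 2 (w, g) ∈ K := by
    set x : WithLp 2 (H × H) := WithLp.toLp 2 (w, g)
    set y := x - K.starProjection x with hy
    have hyK : y ∈ Kᗮ := K.sub_starProjection_mem_orthogonal x
    have hPx : K.starProjection x ∈ K := K.starProjection_apply_mem x
    have hadj : ∀ p ∈ T, inner ℂ y.fst p.2 = inner ℂ y.snd p.1 := by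
      intro p hp
      have h1 := hclos p.2 p.1 (fun q hq => hsymm q hq p hp) _ hPx
      have h2 := h p hp
      simp only [hy, WithLp.sub_fst, WithLp.sub_snd, inner_sub_left, h1]
      exact congrArg (· - _) h2
    have horth : ∀ p ∈ T, inner ℂ y.fst p.1 + inner ℂ y.snd p.2 = 0 := by
      intro p hp
      have hpK : WithLp.toLp 2 p ∈ K := Submodule.le_topologicalClosure _ hp
      have := K.inner_left_of_mem_orthogonal hpK hyK
      simpa [WithLp.prod_inner_apply] using this
    have e1 : y.fst + Complex.I • y.snd = 0 := by
      refine hminus _ fun p hp => ?_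
      have h1 := hadj p hp
      have h2 := horth p hp
      simp only [inner_add_left, inner_sub_right, inner_smul_left, inner_smul_right, Complex.conj_I]
      linear_combination h1 - Complex.I * h2 + (inner ℂ y.snd p.1) * Complex.I_sq
    have e2 : y.fst - Complex.I • y.snd = 0 := by
      refine hplus _ fun p hp => ?_
      have h1 := hadj p hp
      have h2 := horth p hp
      simp only [inner_sub_left, inner_add_right, inner_smul_left, inner_smul_right, Complex.conj_I]
      linear_combination h1 + Complex.I * h2 + (inner ℂ y.snd p.1) * Complex.I_sq
    have f1 : y.fst = 0 := by
      have : (2 : ℂ) • y.fst = 0 := by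
        have := congrArg₂ (· + ·) e1 e2
        simpa [two_smul] using this
      simpa using this
    have f2 : y.snd = 0 := by simpa [f1] using e1
    have hy0 : y = 0 := by
      apply (WithLp.equiv 2 (H × H)).injective
      exact Prod.ext f1 f2
    have : x = K.starProjection x := sub_eq_zero.mp hy0
    rw [this]; exact hPx
  refine hclos g' w' (fun p hp => ?_) _ key
  have := h' p hp
  rw [← inner_conj_symm, ← this, inner_conj_symm]

end

/-! ### The equation `m h - h'' = 0` on the line, and cutoff functions -/

noncomputable section

open scoped SchwartzMap LineDeriv ContDiff Topology
open Filter

/-- On the Fourier side `m - d²/dx²` is multiplication by `m + (2πξ)²`, which is bounded below by `m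
> 0`; its reciprocal is a multiplier of the Schwartz space. -/
theorem exists_schwartzMap_mul_sub_deriv_deriv_eq {m : ℝ} (hm : 0 < m) (f : 𝓢(ℝ, ℂ)) :
    ∃ ψ : 𝓢(ℝ, ℂ), ∀ x, m * ψ x - deriv (deriv ψ) x = f x := by
  let g : ℝ → ℝ := fun ξ => (m + (2 * Real.pi * ξ) ^ 2)⁻¹
  have hg : g.HasTemperateGrowth := by
    have h1 : (fun ξ : ℝ => (2 * Real.pi / Real.sqrt m) * ξ).HasTemperateGrowth := by fun_prop
    -- Up to the factor `1/m`, the multiplier is `(1 + t²)⁻¹` after the rescaling `t = 2πξ/√m`.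
    have h2 := (Function.hasTemperateGrowth_one_add_norm_sq_rpow (H := ℝ) (-1)).comp h1
    have h3 : g = fun ξ => m⁻¹ * ((fun x : ℝ => (1 + ‖x‖ ^ 2) ^ (-1 : ℝ)) ∘
        (fun ξ : ℝ => (2 * Real.pi / Real.sqrt m) * ξ)) ξ := by
      ext ξ
      simp only [g, Function.comp, Real.rpow_neg_one, ← mul_inv, Real.norm_eq_abs, sq_abs]
      congr 1
      rw [mul_pow (2 * Real.pi / Real.sqrt m), div_pow (2 * Real.pi), Real.sq_sqrt hm.le]
      field_simp
    rw [h3]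
    exact (Function.HasTemperateGrowth.const m⁻¹).mul h2
  let ψ := SchwartzMap.fourierMultiplierCLM ℂ g f
  have hderiv : ∀ φ : 𝓢(ℝ, ℂ), ∀ x, deriv φ x = (∂_{(1 : ℝ)} φ : 𝓢(ℝ, ℂ)) x := by
    intro φ x
    rw [SchwartzMap.lineDerivOp_apply_eq_fderiv]
    simp
  refine ⟨ψ, fun x => ?_⟩
  have hd : deriv ψ = (∂_{(1 : ℝ)} ψ : 𝓢(ℝ, ℂ)) := funext (hderiv ψ)
  let q : ℝ → ℝ := fun ξ => inner ℝ ξ (1 : ℝ)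
  have hq : q.HasTemperateGrowth := by fun_prop
  have hqq : ((2 * Real.pi) ^ 2 • (q * q)).HasTemperateGrowth :=
    (Function.HasTemperateGrowth.const ((2 * Real.pi) ^ 2)).mul (hq.mul hq)
  have hdd : (∂_{(1 : ℝ)} (∂_{(1 : ℝ)} ψ) : 𝓢(ℝ, ℂ)) = ((2 * Real.pi * Complex.I) ^ 2) •
      SchwartzMap.fourierMultiplierCLM ℂ (q * q) ψ := by
    rw [SchwartzMap.lineDeriv_eq_fourierMultiplierCLM 1 ψ, LineDeriv.lineDerivOp_smul,
      SchwartzMap.lineDeriv_eq_fourierMultiplierCLM,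
      SchwartzMap.fourierMultiplierCLM_fourierMultiplierCLM_apply hq hq, smul_smul, sq]
  have hsum : f = m • ψ + (2 * Real.pi) ^ 2 • SchwartzMap.fourierMultiplierCLM ℂ (q * q) ψ := by
    have h1 : f = SchwartzMap.fourierMultiplierCLM ℂ
        ((fun _ => m) + (2 * Real.pi) ^ 2 • (q * q)) ψ := by
      rw [SchwartzMap.fourierMultiplierCLM_fourierMultiplierCLM_apply
        ((Function.HasTemperateGrowth.const m).add hqq) hg]
      have : ((fun _ => m) + (2 * Real.pi) ^ 2 • (q * q)) * g = fun _ => 1 := by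
        ext ξ
        have : m + (2 * Real.pi * ξ) ^ 2 ≠ 0 := by positivity
        simp [g, q]
        field_simp
      rw [this, SchwartzMap.fourierMultiplierCLM_const]
      simp
    have hadd : SchwartzMap.fourierMultiplierCLM ℂ ((fun _ => m) + (2 * Real.pi) ^ 2 • (q * q)) ψ =
        SchwartzMap.fourierMultiplierCLM ℂ (fun _ => m) ψ +
          SchwartzMap.fourierMultiplierCLM ℂ ((2 * Real.pi) ^ 2 • (q * q)) ψ := by
      simp only [SchwartzMap.fourierMultiplierCLM_apply]
      rw [SchwartzMap.smulLeftCLM_add (Function.HasTemperateGrowth.const m) hqq]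
      simp [FourierTransform.fourierInv_add]
    rw [hadd, SchwartzMap.fourierMultiplierCLM_const, SchwartzMap.fourierMultiplierCLM_smul (hq.mul hq)] at h1
    exact h1
  rw [hd, hderiv, hdd]
  conv_rhs => rw [hsum]
  simp [mul_pow]

/-- A smooth cutoff function, equal to one on `[1 - T, T]`, and zero outside `[-T, T + 1]`. -/
def plateau (T x : ℝ) : ℝ := Real.smoothTransition (x + T) - Real.smoothTransition (x - T)

theorem contDiff_smoothTransition : ContDiff ℝ ∞ Real.smoothTransition :=
  Real.smoothTransition.contDiff

theorem contDiff_deriv_smoothTransition : ContDiff ℝ ∞ (deriv Real.smoothTransition) :=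
  (contDiff_infty_iff_deriv.1 contDiff_smoothTransition).2

theorem contDiff_plateau (T : ℝ) : ContDiff ℝ ∞ (plateau T) := by
  have := contDiff_smoothTransition
  unfold plateau
  fun_prop

theorem plateau_eq_zero_left {T x : ℝ} (hT : 0 ≤ T) (hx : x ≤ -T) : plateau T x = 0 := by
  rw [plateau, Real.smoothTransition.zero_of_nonpos (by linarith),
    Real.smoothTransition.zero_of_nonpos (by linarith), sub_zero]

theorem plateau_eq_zero_right {T x : ℝ} (hT : 0 ≤ T) (hx : T + 1 ≤ x) : plateau T x = 0 := by
  rw [plateau, Real.smoothTransition.one_of_one_le (by linarith),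
    Real.smoothTransition.one_of_one_le (by linarith), sub_self]

theorem plateau_eq_one {T x : ℝ} (h1 : 1 - T ≤ x) (h2 : x ≤ T) : plateau T x = 1 := by
  rw [plateau, Real.smoothTransition.one_of_one_le (by linarith),
    Real.smoothTransition.zero_of_nonpos (by linarith), sub_zero]

theorem abs_plateau_le_one (T x : ℝ) : |plateau T x| ≤ 1 := by
  rw [plateau, abs_le]
  constructor <;> linarith [Real.smoothTransition.nonneg (x + T), Real.smoothTransition.le_one (x + T),
    Real.smoothTransition.nonneg (x - T), Real.smoothTransition.le_one (x - T)]

theorem hasCompactSupport_plateau {T : ℝ} (hT : 0 ≤ T) : HasCompactSupport (plateau T) := by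
  refine HasCompactSupport.intro (isCompact_Icc (a := -T) (b := T + 1)) fun x hx => ?_
  rw [Set.mem_Icc, not_and_or, not_le, not_le] at hx
  rcases hx with hx | hx
  · exact plateau_eq_zero_left hT hx.le
  · exact plateau_eq_zero_right hT hx.le

/-- The derivative splits into a positive bump on `[-T, 1 - T]` and a negative one on `[T, T + 1]`;
these become the averages over distant cross-sections on the left and on the right. -/
theorem hasDerivAt_plateau (T x : ℝ) : HasDerivAt (plateau T)
    (deriv Real.smoothTransition (x + T) - deriv Real.smoothTransition (x - T)) x := by
  have h (y : ℝ) : HasDerivAt Real.smoothTransition (deriv Real.smoothTransition y) y :=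
    (contDiff_smoothTransition.differentiable (by simp)).differentiableAt.hasDerivAt
  exact ((h (x + T)).comp_add_const x T).sub ((h (x - T)).comp_sub_const x T)

theorem deriv_plateau (T : ℝ) : deriv (plateau T) =
    fun x => deriv Real.smoothTransition (x + T) - deriv Real.smoothTransition (x - T) :=
  funext fun x => (hasDerivAt_plateau T x).deriv

theorem hasDerivAt_deriv_plateau (T x : ℝ) : HasDerivAt (deriv (plateau T))
    (deriv (deriv Real.smoothTransition) (x + T) - deriv (deriv Real.smoothTransition) (x - T)) x := by
  have h (y : ℝ) : HasDerivAt (deriv Real.smoothTransition) (deriv (deriv Real.smoothTransition) y) y :=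
    (contDiff_deriv_smoothTransition.differentiable (by simp)).differentiableAt.hasDerivAt
  rw [deriv_plateau]
  exact ((h (x + T)).comp_add_const x T).sub ((h (x - T)).comp_sub_const x T)

/-- The function is locally constant on the open half-line; the endpoint follows by continuity of
the derivative. -/
theorem deriv_smoothTransition_of_nonpos {x : ℝ} (hx : x ≤ 0) : deriv Real.smoothTransition x = 0 := by
  have hcl : IsClosed {x | deriv Real.smoothTransition x = 0} :=
    isClosed_eq contDiff_deriv_smoothTransition.continuous continuous_const
  have : Set.Iio (0 : ℝ) ⊆ {x | deriv Real.smoothTransition x = 0} := by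
    intro y hy
    have : Real.smoothTransition =ᶠ[𝓝 y] fun _ => 0 := by
      filter_upwards [Iio_mem_nhds hy] with z hz
      exact Real.smoothTransition.zero_of_nonpos hz.le
    simpa using this.deriv_eq
  have h2 := closure_minimal this hcl
  rw [closure_Iio] at h2
  exact h2 hx

theorem deriv_smoothTransition_of_one_le {x : ℝ} (hx : 1 ≤ x) : deriv Real.smoothTransition x = 0 := by
  have hcl : IsClosed {x | deriv Real.smoothTransition x = 0} :=
    isClosed_eq contDiff_deriv_smoothTransition.continuous continuous_const
  have : Set.Ioi (1 : ℝ) ⊆ {x | deriv Real.smoothTransition x = 0} := by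
    intro y hy
    have : Real.smoothTransition =ᶠ[𝓝 y] fun _ => 1 := by
      filter_upwards [Ioi_mem_nhds hy] with z hz
      exact Real.smoothTransition.one_of_one_le (le_of_lt hz)
    simpa using this.deriv_eq
  have h2 := closure_minimal this hcl
  rw [closure_Ioi] at h2
  exact h2 hx

theorem hasCompactSupport_deriv_smoothTransition : HasCompactSupport (deriv Real.smoothTransition) := by
  refine HasCompactSupport.intro (isCompact_Icc (a := (0 : ℝ)) (b := 1)) fun x hx => ?_
  rw [Set.mem_Icc, not_and_or, not_le, not_le] at hx
  rcases hx with hx | hx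
  · exact deriv_smoothTransition_of_nonpos hx.le
  · exact deriv_smoothTransition_of_one_le hx.le

theorem exists_bound_deriv_smoothTransition : ∃ C, ∀ x, |deriv Real.smoothTransition x| ≤ C :=
  hasCompactSupport_deriv_smoothTransition.exists_bound_of_continuous
    contDiff_deriv_smoothTransition.continuous

theorem exists_bound_deriv_deriv_smoothTransition :
    ∃ C, ∀ x, |deriv (deriv Real.smoothTransition) x| ≤ C :=
  hasCompactSupport_deriv_smoothTransition.deriv.exists_bound_of_continuous
    (contDiff_infty_iff_deriv.1 contDiff_deriv_smoothTransition).2.continuous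

theorem eventually_plateau_eq_one (x : ℝ) :
    ∀ᶠ T : ℕ in atTop, plateau T =ᶠ[𝓝 x] fun _ => 1 := by
  filter_upwards [eventually_gt_atTop ⌈|x| + 1⌉₊] with T hT
  have hT' : |x| + 1 < T := lt_of_le_of_lt (Nat.le_ceil _) (by exact_mod_cast hT)
  have h1 := neg_abs_le x
  have h2 := le_abs_self x
  filter_upwards [Ioo_mem_nhds (show 1 - (T : ℝ) < x by linarith) (show x < T by linarith)] with y hy
  exact plateau_eq_one hy.1.le hy.2.le

/-- A square integrable weak solution of `h'' = m h` on the line vanishes. -/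
theorem ae_eq_zero_of_weak_deriv_deriv_eq {m : ℝ} (hm : 0 < m) {h : ℝ → ℂ} (hh : MemLp h 2)
    (H : ∀ ψ : ℝ → ℂ, ContDiff ℝ ∞ ψ → HasCompactSupport ψ →
      ∫ x, h x * starRingEnd ℂ (m * ψ x - deriv (deriv ψ) x) = 0) : ∀ᵐ x, h x = 0 := by
  refine ae_eq_zero_of_integral_contDiff_smul_eq_zero (hh.locallyIntegrable (by norm_num)) ?_
  intro g hg hgc
  have hf1 : ContDiff ℝ ∞ (fun x => (g x : ℂ)) := Complex.ofRealCLM.contDiff.comp hg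
  have hf2 : HasCompactSupport (fun x => (g x : ℂ)) := hgc.comp_left (g := Complex.ofReal) rfl
  let f : 𝓢(ℝ, ℂ) := hf2.toSchwartzMap hf1
  -- Duality: an arbitrary test function `g` is written as `mψ - ψ''`. As `ψ` is only Schwartz, the
  -- hypothesis is applied to `plateau T * ψ` and `T` tends to infinity.
  obtain ⟨ψ, hψ⟩ := exists_schwartzMap_mul_sub_deriv_deriv_eq hm f
  obtain ⟨C, hC⟩ := exists_bound_deriv_smoothTransition
  obtain ⟨C', hC'⟩ := exists_bound_deriv_deriv_smoothTransition
  have hψs : ContDiff ℝ ∞ ψ := ψ.smooth _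
  have hψd : ContDiff ℝ ∞ (deriv ψ) := (contDiff_infty_iff_deriv.1 hψs).2
  have hder1 (x : ℝ) : HasDerivAt ψ (deriv ψ x) x :=
    (hψs.differentiable (by simp)).differentiableAt.hasDerivAt
  have hder2 (x : ℝ) : HasDerivAt (deriv ψ) (deriv (deriv ψ) x) x :=
    (hψd.differentiable (by simp)).differentiableAt.hasDerivAt
  -- This is `(m - d²/dx²)(plateau T * ψ)` by Leibniz' rule.
  let F : ℕ → ℝ → ℂ := fun T x => (plateau T x : ℂ) * f x -
    2 * ((deriv (plateau T) x : ℝ) : ℂ) * deriv ψ x - ((deriv (deriv (plateau T)) x : ℝ) : ℂ) * ψ x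
  have hF : ∀ T : ℕ, ∫ x, h x * starRingEnd ℂ (F T x) = 0 := by
    intro T
    have hp := contDiff_plateau T
    have := H (fun x => (plateau T x : ℂ) * ψ x) ((Complex.ofRealCLM.contDiff.comp hp).mul hψs)
      ((hasCompactSupport_plateau (Nat.cast_nonneg T)).comp_left (g := Complex.ofReal) rfl).mul_right
    rw [← this]
    refine integral_congr_ae (ae_of_all _ fun x => ?_)
    have e1 : deriv (fun x => (plateau T x : ℂ) * ψ x) = fun x =>
        ((deriv (plateau T) x : ℝ) : ℂ) * ψ x + (plateau T x : ℂ) * deriv ψ x := by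
      funext x
      have := ((hasDerivAt_plateau T x).differentiableAt.hasDerivAt.ofReal_comp).mul (hder1 x)
      exact this.deriv
    have e2 : deriv (deriv (fun x => (plateau T x : ℂ) * ψ x)) x =
        ((deriv (deriv (plateau T)) x : ℝ) : ℂ) * ψ x + ((deriv (plateau T) x : ℝ) : ℂ) * deriv ψ x +
        (((deriv (plateau T) x : ℝ) : ℂ) * deriv ψ x + (plateau T x : ℂ) * deriv (deriv ψ) x) := by
      rw [e1]
      have := (((hasDerivAt_deriv_plateau T x).differentiableAt.hasDerivAt.ofReal_comp).mul (hder1 x)).add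
        (((hasDerivAt_plateau T x).differentiableAt.hasDerivAt.ofReal_comp).mul (hder2 x))
      exact this.deriv
    simp only [F]
    rw [e2, ← hψ x]
    congr 2
    ring
  have hlim : Tendsto (fun T : ℕ => ∫ x, h x * starRingEnd ℂ (F T x)) atTop
      (𝓝 (∫ x, h x * starRingEnd ℂ (f x))) := by
    refine tendsto_integral_of_dominated_convergence
      (fun x => ‖h x‖ * (‖f x‖ + 4 * C * ‖deriv ψ x‖ + 2 * C' * ‖ψ x‖)) ?_ ?_ ?_ ?_
    · intro T
      refine hh.aestronglyMeasurable.mul (Continuous.aestronglyMeasurable ?_)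
      have c0 := (contDiff_plateau T).continuous
      have c1 := (contDiff_infty_iff_deriv.1 (contDiff_plateau T)).2
      have c2 := (contDiff_infty_iff_deriv.1 c1).2.continuous
      have c3 := hψd.continuous
      have c4 := hψs.continuous
      have c5 := f.continuous
      have c6 := c1.continuous
      refine Complex.continuous_conj.comp ?_
      fun_prop
    · have hd : MemLp (deriv ψ) 2 := by
        have : deriv ψ = (∂_{(1 : ℝ)} ψ : 𝓢(ℝ, ℂ)) := by
          funext x
          rw [SchwartzMap.lineDerivOp_apply_eq_fderiv]
          simp
        rw [this]
        exact SchwartzMap.memLp _ 2 _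
      have := hh.norm.integrable_mul (((f.memLp 2 volume).norm.add (hd.norm.const_mul (4 * C))).add
        ((ψ.memLp 2 volume).norm.const_mul (2 * C')))
      exact this
    · intro T
      refine ae_of_all _ fun x => ?_
      rw [norm_mul, RCLike.norm_conj]
      gcongr
      have b0 : ‖(plateau T x : ℂ)‖ ≤ 1 := by
        rw [Complex.norm_real]; exact abs_plateau_le_one T x
      have b1 : ‖((deriv (plateau T) x : ℝ) : ℂ)‖ ≤ 2 * C := by
        rw [Complex.norm_real, deriv_plateau]
        refine (norm_sub_le _ _).trans ?_
        rw [two_mul]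
        exact add_le_add (hC _) (hC _)
      have b2 : ‖((deriv (deriv (plateau T)) x : ℝ) : ℂ)‖ ≤ 2 * C' := by
        rw [Complex.norm_real, (hasDerivAt_deriv_plateau T x).deriv]
        refine (norm_sub_le _ _).trans ?_
        rw [two_mul]
        exact add_le_add (hC' _) (hC' _)
      calc ‖F T x‖ ≤ ‖(plateau T x : ℂ) * f x‖ + ‖2 * ((deriv (plateau T) x : ℝ) : ℂ) * deriv ψ x‖ +
            ‖((deriv (deriv (plateau T)) x : ℝ) : ℂ) * ψ x‖ :=
            (norm_sub_le _ _).trans (by gcongr; exact norm_sub_le _ _)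
        _ ≤ 1 * ‖f x‖ + 2 * (2 * C) * ‖deriv ψ x‖ + 2 * C' * ‖ψ x‖ := by
            simp only [norm_mul, RCLike.norm_ofNat]
            gcongr
        _ = _ := by ring
    · refine ae_of_all _ fun x => ?_
      refine tendsto_const_nhds.congr' ?_
      filter_upwards [eventually_plateau_eq_one x] with T hT
      have h0 : plateau T x = 1 := hT.self_of_nhds
      have h1 : deriv (plateau T) =ᶠ[𝓝 x] fun _ => 0 := by simpa using hT.deriv
      have h2 : deriv (deriv (plateau T)) x = 0 := by simpa using h1.deriv_eq
      simp [F, h0, h1.self_of_nhds, h2]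
  have hzero := tendsto_nhds_unique hlim (by simp_rw [hF]; exact tendsto_const_nhds)
  rw [← hzero]
  refine integral_congr_ae (ae_of_all _ fun x => ?_)
  have : f x = (g x : ℂ) := rfl
  simp [this, mul_comm]

end

/-! ### Symmetry of the Dirac operator on test functions -/

noncomputable section

open scoped ContDiff Topology
open Filter

namespace Nanoribbon

theorem stripMeasure_eq_prod (L : ℝ) :
    stripMeasure L = (volume : Measure ℝ).prod (volume.restrict (Set.Ioo 0 L)) := by
  have : strip L = Set.univ ×ˢ Set.Ioo 0 L := by ext p; simp [strip]
  rw [stripMeasure, this, Measure.volume_eq_prod, ← Measure.prod_restrict, Measure.restrict_univ]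

theorem measurableSet_strip (L : ℝ) : MeasurableSet (strip L) := by
  have : strip L = Set.univ ×ˢ Set.Ioo 0 L := by ext p; simp [strip]
  rw [this]
  exact MeasurableSet.univ.prod measurableSet_Ioo

/-- Test functions: smooth, compactly supported, subject to the boundary conditions. -/
structure IsTest (L : ℝ) (φ : ℝ × ℝ → Spinor) : Prop where
  contDiff : ContDiff ℝ ∞ φ
  hasCompactSupport : HasCompactSupport φ
  bc : ArmchairBC L φ

theorem contDiff_dirac {φ : ℝ × ℝ → Spinor} (hφ : ContDiff ℝ ∞ φ) : ContDiff ℝ ∞ (dirac φ) := by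
  have hX (v : ℝ × ℝ) : ContDiff ℝ ∞ fun p => fderiv ℝ φ p v :=
    (hφ.fderiv_right (by simp)).clm_apply contDiff_const
  have h (v : ℝ × ℝ) (i : Fin 4) : ContDiff ℝ ∞ fun p => fderiv ℝ φ p v i :=
    contDiff_pi.1 (hX v) i
  have h1 (i) := h (1, 0) i
  have h2 (i) := h (0, 1) i
  refine contDiff_pi.2 fun i => ?_
  fin_cases i <;> simp only [dirac, partialX, partialY] <;> simp <;> fun_prop

theorem hasCompactSupport_dirac {φ : ℝ × ℝ → Spinor} (hφ : HasCompactSupport φ) :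
    HasCompactSupport (dirac φ) := by
  refine (hφ.fderiv (𝕜 := ℝ)).mono fun p hp => ?_
  contrapose! hp
  have : fderiv ℝ φ p = 0 := by simpa using hp
  simp only [Function.mem_support, not_not]
  ext i
  fin_cases i <;> simp [dirac, partialX, partialY, this]

theorem continuous_pairing {X : Type*} [TopologicalSpace X] {φ ψ : X → Spinor} (hφ : Continuous φ)
    (hψ : Continuous ψ) : Continuous fun p => pairing (φ p) (ψ p) := by
  unfold pairing
  refine continuous_finsetSum _ fun i _ => ?_
  exact ((continuous_apply i).comp hφ).mul
    (Complex.continuous_conj.comp ((continuous_apply i).comp hψ))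

theorem fderiv_mul_conj {φ ψ : ℝ × ℝ → Spinor} (hφ : Differentiable ℝ φ) (hψ : Differentiable ℝ ψ)
    (i j : Fin 4) (p v : ℝ × ℝ) :
    HasFDerivAt (fun p => φ p i * starRingEnd ℂ (ψ p j))
      (fderiv ℝ (fun p => φ p i * starRingEnd ℂ (ψ p j)) p) p ∧
    fderiv ℝ (fun p => φ p i * starRingEnd ℂ (ψ p j)) p v =
      fderiv ℝ φ p v i * starRingEnd ℂ (ψ p j) + φ p i * starRingEnd ℂ (fderiv ℝ ψ p v j) := by
  have h1 : HasFDerivAt (fun p => φ p i) ((ContinuousLinearMap.proj i).comp (fderiv ℝ φ p)) p :=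
    hasFDerivAt_pi'.1 (hφ p).hasFDerivAt i
  have h2 : HasFDerivAt (fun p => ψ p j) ((ContinuousLinearMap.proj j).comp (fderiv ℝ ψ p)) p :=
    hasFDerivAt_pi'.1 (hψ p).hasFDerivAt j
  have h3 : HasFDerivAt (fun p => starRingEnd ℂ (ψ p j))
      ((Complex.conjCLE : ℂ →L[ℝ] ℂ).comp ((ContinuousLinearMap.proj j).comp (fderiv ℝ ψ p))) p :=
    (Complex.conjCLE : ℂ →L[ℝ] ℂ).hasFDerivAt.comp p h2
  have h4 := h1.mul h3
  refine ⟨h4.differentiableAt.hasFDerivAt, ?_⟩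
  have h5 := h4.fderiv
  rw [show (fun p => φ p i * starRingEnd ℂ (ψ p j)) =
    (fun p => φ p i) * (fun p => starRingEnd ℂ (ψ p j)) from rfl, h5]
  simp
  ring

/-- The divergence theorem on `[-R, R] × [0, L]`, with `R` beyond both supports, so that only the
edges could contribute. -/
theorem integral_strip_divergence {L : ℝ} (hL : 0 < L) {f g : ℝ × ℝ → ℂ} (hf : ContDiff ℝ 1 f)
    (hg : ContDiff ℝ 1 g) (hfc : HasCompactSupport f) (hgc : HasCompactSupport g)
    (h0 : ∀ x, g (x, 0) = 0) (hL' : ∀ x, g (x, L) = 0) :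
    ∫ p, (fderiv ℝ f p (1, 0) + fderiv ℝ g p (0, 1)) ∂(stripMeasure L) = 0 := by
  obtain ⟨R, hR⟩ : ∃ R > 0, ∀ p : ℝ × ℝ, R ≤ |p.1| → f p = 0 ∧ fderiv ℝ f p = 0 ∧ fderiv ℝ g p = 0 := by
    have hK := (hfc.isCompact.union (hgc.isCompact)).isBounded
    obtain ⟨R, hR⟩ := hK.subset_closedBall 0
    refine ⟨max R 0 + 1, by positivity, fun p hp => ?_⟩
    have hn : p ∉ tsupport f ∪ tsupport g := by
      intro h
      have := hR h
      rw [mem_closedBall_zero_iff] at this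
      have h2 : |p.1| ≤ ‖p‖ := norm_fst_le p
      linarith [le_max_left R 0]
    rw [Set.mem_union, not_or] at hn
    refine ⟨image_eq_zero_of_notMem_tsupport hn.1, ?_, ?_⟩
    · exact image_eq_zero_of_notMem_tsupport fun h => hn.1 (tsupport_fderiv_subset ℝ h)
    · exact image_eq_zero_of_notMem_tsupport fun h => hn.2 (tsupport_fderiv_subset ℝ h)
  obtain ⟨hR0, hR⟩ := hR
  have hcf : Continuous fun p => fderiv ℝ f p (1, 0) :=
    (hf.continuous_fderiv (by simp)).clm_apply continuous_const
  have hcg : Continuous fun p => fderiv ℝ g p (0, 1) :=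
    (hg.continuous_fderiv (by simp)).clm_apply continuous_const
  have key := integral_divergence_prod_Icc_of_hasFDerivAt_of_le f g (fderiv ℝ f) (fderiv ℝ g)
    (-R, 0) (R, L) ⟨by simp; linarith, hL.le⟩ hf.continuous.continuousOn hg.continuous.continuousOn
    (fun p _ => (hf.differentiable (by simp) p).hasFDerivAt)
    (fun p _ => (hg.differentiable (by simp) p).hasFDerivAt)
    ((hcf.add hcg).continuousOn.integrableOn_compact isCompact_Icc)
  have e1 : ∀ y, f (R, y) = 0 := fun y => (hR (R, y) (le_abs_self R)).1
  have e2 : ∀ y, f (-R, y) = 0 := fun y => (hR (-R, y) (by simp [abs_of_pos hR0])).1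
  simp only [h0, hL', e1, e2, intervalIntegral.integral_zero, sub_zero, add_zero] at key
  rw [← key, stripMeasure]
  have hae : strip L =ᵐ[volume] (Set.univ ×ˢ Set.Icc 0 L : Set (ℝ × ℝ)) := by
    have : strip L = Set.univ ×ˢ Set.Ioo 0 L := by ext p; simp [strip]
    rw [this, Measure.volume_eq_prod]
    exact Measure.set_prod_ae_eq (ae_eq_refl _) Ioo_ae_eq_Icc
  rw [setIntegral_congr_set hae]
  refine setIntegral_eq_of_subset_of_forall_sdiff_eq_zero (MeasurableSet.univ.prod measurableSet_Icc)
    (fun p hp => ⟨trivial, hp.1.2, hp.2.2⟩) fun p hp => ?_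
  have : R ≤ |p.1| := by
    by_contra! h
    rw [abs_lt] at h
    exact hp.2 ⟨⟨h.1.le, hp.1.2.1⟩, ⟨h.2.le, hp.1.2.2⟩⟩
  simp [hR p this]

/-- The difference of the two integrands is a divergence. On each edge the boundary conditions
express the primed components as unimodular multiples of the unprimed ones, and the four terms of
the flux in the direction of `y` cancel in pairs. -/
theorem integral_pairing_dirac_comm {L : ℝ} (hL : 0 < L) {φ ψ : ℝ × ℝ → Spinor} (hφ : IsTest L φ)
    (hψ : IsTest L ψ) :
    ∫ p, pairing (φ p) (dirac ψ p) ∂(stripMeasure L) =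
      ∫ p, pairing (dirac φ p) (ψ p) ∂(stripMeasure L) := by
  have hφd := hφ.contDiff.differentiable (by simp)
  have hψd := hψ.contDiff.differentiable (by simp)
  have hs (i j : Fin 4) : ContDiff ℝ 1 fun p => φ p i * starRingEnd ℂ (ψ p j) := by
    refine (contDiff_pi.1 (hφ.contDiff.of_le (by simp)) i).mul ?_
    exact Complex.conjCLE.contDiff.comp (contDiff_pi.1 (hψ.contDiff.of_le (by simp)) j)
  have hc (i j : Fin 4) : HasCompactSupport fun p => φ p i * starRingEnd ℂ (ψ p j) :=
    (hφ.hasCompactSupport.comp_left (g := fun a : Spinor => a i) rfl).mul_right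
  set Q : Fin 4 → Fin 4 → ℝ × ℝ → ℂ := fun i j p => φ p i * starRingEnd ℂ (ψ p j) with hQ
  have hQd (i j : Fin 4) (p : ℝ × ℝ) : HasFDerivAt (Q i j) (fderiv ℝ (Q i j) p) p :=
    (fderiv_mul_conj hφd hψd i j p 0).1
  have hQv (i j : Fin 4) (p v : ℝ × ℝ) : fderiv ℝ (Q i j) p v =
      fderiv ℝ φ p v i * starRingEnd ℂ (ψ p j) + φ p i * starRingEnd ℂ (fderiv ℝ ψ p v j) :=
    (fderiv_mul_conj hφd hψd i j p v).2
  have key := integral_strip_divergence hL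
    (f := fun p => Complex.I * (Q 1 0 p + Q 0 1 p - Q 3 2 p - Q 2 3 p))
    (g := fun p => Q 1 0 p - Q 0 1 p + Q 3 2 p - Q 2 3 p)
    (contDiff_const.mul ((((hs 1 0).add (hs 0 1)).sub (hs 3 2)).sub (hs 2 3)))
    ((((hs 1 0).sub (hs 0 1)).add (hs 3 2)).sub (hs 2 3))
    ((((hc 1 0).add (hc 0 1)).sub (hc 3 2)).sub (hc 2 3)).mul_left
    ((((hc 1 0).sub (hc 0 1)).add (hc 3 2)).sub (hc 2 3)) ?_ ?_
  · rw [eq_comm, ← sub_eq_zero, ← integral_sub, ← key]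
    · refine integral_congr_ae (ae_of_all _ fun p => ?_)
      have e1 : HasFDerivAt (fun p => Complex.I * (Q 1 0 p + Q 0 1 p - Q 3 2 p - Q 2 3 p)) _ p :=
        ((((hQd 1 0 p).add (hQd 0 1 p)).sub (hQd 3 2 p)).sub (hQd 2 3 p)).const_mul Complex.I
      have e2 : HasFDerivAt (fun p => Q 1 0 p - Q 0 1 p + Q 3 2 p - Q 2 3 p) _ p :=
        ((((hQd 1 0 p).sub (hQd 0 1 p)).add (hQd 3 2 p)).sub (hQd 2 3 p))
      simp only [e1.fderiv, e2.fderiv]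
      simp only [smul_apply, add_apply,
        sub_apply, hQv]
      simp [pairing, dirac, partialX, partialY, Fin.sum_univ_four]
      ring
    · refine Integrable.mono_measure ?_ Measure.restrict_le_self
      refine (continuous_pairing (contDiff_dirac hφ.contDiff).continuous
        hψ.contDiff.continuous).integrable_of_hasCompactSupport ?_
      refine hψ.hasCompactSupport.mono fun p hp => ?_
      contrapose! hp
      simp only [Function.mem_support, not_not] at hp ⊢
      simp [pairing, hp]
    · refine Integrable.mono_measure ?_ Measure.restrict_le_self
      refine (continuous_pairing hφ.contDiff.continuous
        (contDiff_dirac hψ.contDiff).continuous).integrable_of_hasCompactSupport ?_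
      refine hφ.hasCompactSupport.mono fun p hp => ?_
      contrapose! hp
      simp only [Function.mem_support, not_not] at hp ⊢
      simp [pairing, hp]
  · intro x
    obtain ⟨a1, a2, -, -⟩ := hφ.bc x
    obtain ⟨b1, b2, -, -⟩ := hψ.bc x
    have a1' : φ (x, 0) 0 = Complex.I * φ (x, 0) 2 := by linear_combination a1
    have a2' : φ (x, 0) 3 = Complex.I * φ (x, 0) 1 := by linear_combination a2
    have b1' : ψ (x, 0) 0 = Complex.I * ψ (x, 0) 2 := by linear_combination b1
    have b2' : ψ (x, 0) 3 = Complex.I * ψ (x, 0) 1 := by linear_combination b2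
    simp only [hQ, a1', a2', b1', b2', map_mul, Complex.conj_I]
    ring
  · intro x
    obtain ⟨-, -, a1, a2⟩ := hφ.bc x
    obtain ⟨-, -, b1, b2⟩ := hψ.bc x
    set θ := Complex.exp (-(2 * Real.pi * L * Complex.I)) with hθ
    have hθ1 : θ * starRingEnd ℂ θ = 1 := by
      rw [hθ, ← Complex.exp_conj, ← Complex.exp_add]
      simp [map_ofNat (starRingEnd ℂ) 2]
    have a1' : φ (x, L) 2 = -Complex.I * θ * φ (x, L) 0 := by
      linear_combination Complex.I * a1 + φ (x, L) 2 * Complex.I_sq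
    have a2' : φ (x, L) 3 = Complex.I * θ * φ (x, L) 1 := by linear_combination a2
    have b1' : ψ (x, L) 2 = -Complex.I * θ * ψ (x, L) 0 := by
      linear_combination Complex.I * b1 + ψ (x, L) 2 * Complex.I_sq
    have b2' : ψ (x, L) 3 = Complex.I * θ * ψ (x, L) 1 := by linear_combination b2
    simp only [hQ, a1', a2', b1', b2', map_mul, map_neg, Complex.conj_I]
    linear_combination (φ (x, L) 1 * starRingEnd ℂ (ψ (x, L) 0) - φ (x, L) 0 * starRingEnd ℂ (ψ (x, L) 1)) *
      (θ * starRingEnd ℂ θ * Complex.I_sq - hθ1)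

/-! ### Transverse modes -/

theorem memLp_of_norm_eq {X : Type*} [MeasurableSpace X] {μ : Measure X} {f g : X → ℂ}
    (hf : MemLp f 2 μ) (hg : AEStronglyMeasurable g μ) (h : ∀ x, ‖g x‖ = ‖f x‖) : MemLp g 2 μ :=
  hf.mono hg (ae_of_all _ fun x => (h x).le)

/-- Completeness of the transverse modes. -/
theorem ae_eq_zero_of_transverse_coefficients {L : ℝ} (hL : 0 < L) {u u' : ℝ → ℂ}
    (hu : MemLp u 2 (volume.restrict (Set.Ioo 0 L))) (hu' : MemLp u' 2 (volume.restrict (Set.Ioo 0 L)))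
    (H : ∀ j : ℤ, ∫ y in Set.Ioo 0 L,
      (u y * Complex.exp (-(Complex.I * (Real.pi + Real.pi * j / L : ℝ) * y)) +
        Complex.I * (u' y * Complex.exp (Complex.I * (Real.pi + Real.pi * j / L : ℝ) * y))) = 0) :
    (∀ᵐ y ∂(volume.restrict (Set.Ioo 0 L)), u y = 0) ∧
      ∀ᵐ y ∂(volume.restrict (Set.Ioo 0 L)), u' y = 0 := by
  set a : ℝ → ℂ := (Set.Ioo 0 L).indicator u with ha
  set b : ℝ → ℂ := (Set.Ioo 0 L).indicator u' with hb
  have ham : MemLp a 2 := (memLp_indicator_iff_restrict measurableSet_Ioo).2 hu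
  have hbm : MemLp b 2 := (memLp_indicator_iff_restrict measurableSet_Ioo).2 hu'
  have hai : Integrable a :=
    (integrable_indicator_iff measurableSet_Ioo).2 (hu.integrable (by norm_num))
  have hbi : Integrable b :=
    (integrable_indicator_iff measurableSet_Ioo).2 (hu'.integrable (by norm_num))
  have hnorm (c y : ℝ) : ‖Complex.exp (Complex.I * c * y)‖ = 1 := by
    rw [show Complex.I * c * y = ((c * y : ℝ) : ℂ) * Complex.I by push_cast; ring,
      Complex.norm_exp_ofReal_mul_I]
  have hcont (c : ℝ) : Continuous fun y : ℝ => Complex.exp (Complex.I * c * y) := by fun_prop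
  -- Unfolding: `u` on `(0, L)` and the reflection of `i u'` on `(-L, 0)` form one function on an
  -- interval of length `2L`. The factor `e^{-iπy}` removes the offset `π` from `κ`, which leaves
  -- the Fourier frequencies `πj/L` of period `2L`.
  let U : ℝ → ℂ := fun y => (a y + Complex.I * b (-y)) * Complex.exp (Complex.I * (-Real.pi : ℝ) * y)
  have hUm : MemLp U 2 := by
    have h1 : MemLp (fun y => b (-y)) 2 :=
      hbm.comp_measurePreserving (Measure.measurePreserving_neg volume)
    have h2 := ham.add (h1.const_mul Complex.I)
    exact memLp_of_norm_eq h2 (h2.aestronglyMeasurable.mul (hcont _).aestronglyMeasurable)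
      fun x => by simp only [U, norm_mul, hnorm, mul_one]; rfl
  have hU0 : ∀ y, y ∉ Set.Ioc (-L) L → U y = 0 := by
    intro y hy
    have h1 : a y = 0 := Set.indicator_of_notMem (fun h => hy ⟨by linarith [h.1], h.2.le⟩) _
    have h2 : b (-y) = 0 := by
      by_cases hy' : -y ∈ Set.Ioo 0 L
      · exact absurd ⟨by linarith [hy'.2], by linarith [hy'.1]⟩ hy
      · exact Set.indicator_of_notMem hy' _
    simp [U, h1, h2]
  have hab : -L < L := by linarith
  have hcoef : ∀ j, fourierCoeffOn hab U j = 0 := by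
    intro j
    rw [fourierCoeffOn_eq_integral, intervalIntegral.integral_of_le hab.le]
    convert smul_zero _
    rw [setIntegral_eq_integral_of_forall_compl_eq_zero (fun y hy => by simp [hU0 y hy])]
    set κ : ℝ := Real.pi + Real.pi * j / L with hκ
    have hpt : ∀ y : ℝ, fourier (-j) (y : AddCircle (L - -L)) • U y =
        a y * Complex.exp (-(Complex.I * κ * y)) +
          Complex.I * (b (-y) * Complex.exp (Complex.I * κ * (-y : ℝ))) := by
      intro y
      have : fourier (-j) (y : AddCircle (L - -L)) * Complex.exp (Complex.I * (-Real.pi : ℝ) * y) =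
          Complex.exp (-(Complex.I * κ * y)) := by
        rw [fourier_coe_apply, ← Complex.exp_add]
        congr 1
        have : (L : ℂ) ≠ 0 := by exact_mod_cast hL.ne'
        rw [hκ]
        push_cast
        have h2 : (L : ℂ) - -L ≠ 0 := by
          rw [sub_neg_eq_add, ← two_mul]; exact mul_ne_zero two_ne_zero this
        field_simp
        ring
      simp only [U, smul_eq_mul]
      rw [show Complex.I * (κ : ℂ) * ((-y : ℝ) : ℂ) = -(Complex.I * κ * y) by push_cast; ring, ← this]
      ring
    simp_rw [hpt]
    have i1 : Integrable fun y : ℝ => a y * Complex.exp (-(Complex.I * κ * y)) := by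
      refine hai.mono (hai.aestronglyMeasurable.mul (Continuous.aestronglyMeasurable (by fun_prop)))
        (ae_of_all _ fun y => ?_)
      have := hnorm (-κ) y
      rw [norm_mul, show -(Complex.I * (κ : ℂ) * y) = Complex.I * ((-κ : ℝ) : ℂ) * y by push_cast; ring,
        this, mul_one]
    have i2 : Integrable fun y : ℝ => b y * Complex.exp (Complex.I * κ * y) := by
      refine hbi.mono (hbi.aestronglyMeasurable.mul (hcont κ).aestronglyMeasurable)
        (ae_of_all _ fun y => ?_)
      rw [norm_mul, hnorm, mul_one]
    have i3 : Integrable fun y : ℝ => b (-y) * Complex.exp (Complex.I * κ * (-y : ℝ)) :=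
      i2.comp_neg
    rw [integral_add i1 (i3.const_mul _), integral_const_mul,
      integral_neg_eq_self (fun y : ℝ => b y * Complex.exp (Complex.I * κ * y)), ← H j,
      ← integral_indicator measurableSet_Ioo, ← integral_const_mul,
      ← integral_add i1 (i2.const_mul _)]
    refine integral_congr_ae (ae_of_all _ fun y => ?_)
    by_cases hy : y ∈ Set.Ioo 0 L
    · simp [ha, hb, hy, hκ]
    · simp [ha, hb, hy]
  have hpars := hasSum_sq_fourierCoeffOn hab (hUm.restrict (Set.Ioc (-L) L))
  simp only [hcoef, norm_zero, ne_eq, OfNat.ofNat_ne_zero, not_false_eq_true, zero_pow] at hpars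
  have hz := hpars.unique hasSum_zero
  rw [intervalIntegral.integral_of_le hab.le,
    setIntegral_eq_integral_of_forall_compl_eq_zero (fun y hy => by simp [hU0 y hy])] at hz
  have hz' : ∫ y, ‖U y‖ ^ 2 = 0 := by
    rcases smul_eq_zero.1 hz with h | h
    · exact absurd h (inv_ne_zero (by linarith))
    · exact h
  rw [integral_eq_zero_iff_of_nonneg (fun y => by positivity)
    ((memLp_two_iff_integrable_sq_norm hUm.1).1 hUm)] at hz'
  have hzero : ∀ᵐ y, a y + Complex.I * b (-y) = 0 := by
    filter_upwards [hz'] with y hy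
    have : U y = 0 := by simpa using hy
    simpa [U] using this
  have hneg : ∀ᵐ y, a (-y) + Complex.I * b y = 0 := by
    have := (Measure.measurePreserving_neg (volume : Measure ℝ)).quasiMeasurePreserving.ae hzero
    simpa using this
  constructor
  · filter_upwards [ae_restrict_of_ae hzero, ae_restrict_mem measurableSet_Ioo] with y hy hy'
    have : b (-y) = 0 := Set.indicator_of_notMem (fun h => by linarith [h.1, hy'.1]) _
    simpa [this, ha, hy'] using hy
  · filter_upwards [ae_restrict_of_ae hneg, ae_restrict_mem measurableSet_Ioo] with y hy hy'
    have : a (-y) = 0 := Set.indicator_of_notMem (fun h => by linarith [h.1, hy'.1]) _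
    simpa [this, hb, hy'] using hy

/-- The function with transverse wave number `κ` and longitudinal profiles `a`, `b`. -/
def modeFn (κ : ℝ) (a b : ℝ → ℂ) (p : ℝ × ℝ) : Spinor :=
  ![a p.1 * Complex.exp (Complex.I * κ * p.2), b p.1 * Complex.exp (Complex.I * κ * p.2),
    -Complex.I * (a p.1 * Complex.exp (-(Complex.I * κ * p.2))),
    Complex.I * (b p.1 * Complex.exp (-(Complex.I * κ * p.2)))]

theorem contDiff_modeFn {n : WithTop ℕ∞} (κ : ℝ) {a b : ℝ → ℂ} (ha : ContDiff ℝ n a) (hb : ContDiff ℝ n b) :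
    ContDiff ℝ n (modeFn κ a b) := by
  have h2 : ContDiff ℝ n fun p : ℝ × ℝ => (p.2 : ℂ) := Complex.ofRealCLM.contDiff.comp contDiff_snd
  have ha' : ContDiff ℝ n fun p : ℝ × ℝ => a p.1 := ha.comp contDiff_fst
  have hb' : ContDiff ℝ n fun p : ℝ × ℝ => b p.1 := hb.comp contDiff_fst
  refine contDiff_pi.2 fun i => ?_
  fin_cases i <;> simp [modeFn] <;> fun_prop

theorem partialX_apply_of_hasDerivAt {φ : ℝ × ℝ → Spinor} {p : ℝ × ℝ} (hφ : DifferentiableAt ℝ φ p)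
    {i : Fin 4} {d : ℂ} (h : HasDerivAt (fun t => φ (t, p.2) i) d p.1) : partialX φ p i = d := by
  have h1 : HasDerivAt (fun t : ℝ => (t, p.2)) (1, 0) p.1 :=
    (hasDerivAt_id p.1).prodMk (hasDerivAt_const p.1 p.2)
  have h2 := hφ.hasFDerivAt.comp_hasDerivAt p.1 h1
  exact (hasDerivAt_pi.1 h2 i).unique h

theorem partialY_apply_of_hasDerivAt {φ : ℝ × ℝ → Spinor} {p : ℝ × ℝ} (hφ : DifferentiableAt ℝ φ p)
    {i : Fin 4} {d : ℂ} (h : HasDerivAt (fun t => φ (p.1, t) i) d p.2) : partialY φ p i = d := by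
  have h1 : HasDerivAt (fun t : ℝ => (p.1, t)) (0, 1) p.2 :=
    (hasDerivAt_const p.2 p.1).prodMk (hasDerivAt_id p.2)
  have h2 := hφ.hasFDerivAt.comp_hasDerivAt p.2 h1
  exact (hasDerivAt_pi.1 h2 i).unique h

/-- `𝒟` preserves each transverse mode and acts on the profiles by first-order operators whose
square is `-∂ₓ² + κ²` on both components. -/
theorem dirac_modeFn (κ : ℝ) {a b : ℝ → ℂ} (ha : ContDiff ℝ 1 a) (hb : ContDiff ℝ 1 b) :
    dirac (modeFn κ a b) = modeFn κ (fun x => Complex.I * (deriv b x + κ * b x))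
      (fun x => Complex.I * (deriv a x - κ * a x)) := by
  funext p
  have hd : DifferentiableAt ℝ (modeFn κ a b) p :=
    (contDiff_modeFn κ ha hb).differentiable (by simp) p
  have hda : HasDerivAt a (deriv a p.1) p.1 := (ha.differentiable (by simp) p.1).hasDerivAt
  have hdb : HasDerivAt b (deriv b p.1) p.1 := (hb.differentiable (by simp) p.1).hasDerivAt
  have he : HasDerivAt (fun t : ℝ => Complex.exp (Complex.I * κ * t))
      (Complex.exp (Complex.I * κ * p.2) * (Complex.I * κ)) p.2 := by
    have := ((Complex.ofRealCLM.hasDerivAt (x := p.2)).const_mul (Complex.I * κ)).cexp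
    simpa using this
  have he' : HasDerivAt (fun t : ℝ => Complex.exp (-(Complex.I * κ * t)))
      (-(Complex.exp (-(Complex.I * κ * p.2)) * (Complex.I * κ))) p.2 := by
    have := ((Complex.ofRealCLM.hasDerivAt (x := p.2)).const_mul (Complex.I * κ)).neg.cexp
    simpa using this
  have x0 := partialX_apply_of_hasDerivAt (i := 0) hd (hda.mul_const (Complex.exp (Complex.I * κ * p.2)))
  have x1 := partialX_apply_of_hasDerivAt (i := 1) hd (hdb.mul_const (Complex.exp (Complex.I * κ * p.2)))
  have x2 := partialX_apply_of_hasDerivAt (i := 2) hd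
    ((hda.mul_const (Complex.exp (-(Complex.I * κ * p.2)))).const_mul (-Complex.I))
  have x3 := partialX_apply_of_hasDerivAt (i := 3) hd
    ((hdb.mul_const (Complex.exp (-(Complex.I * κ * p.2)))).const_mul Complex.I)
  have y0 := partialY_apply_of_hasDerivAt (i := 0) hd (he.const_mul (a p.1))
  have y1 := partialY_apply_of_hasDerivAt (i := 1) hd (he.const_mul (b p.1))
  have y2 := partialY_apply_of_hasDerivAt (i := 2) hd ((he'.const_mul (a p.1)).const_mul (-Complex.I))
  have y3 := partialY_apply_of_hasDerivAt (i := 3) hd ((he'.const_mul (b p.1)).const_mul Complex.I)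
  ext i
  fin_cases i
  · simp only [dirac, x0, x1, x2, x3, y0, y1, y2, y3, modeFn]
    simp; ring
  · simp only [dirac, x0, x1, x2, x3, y0, y1, y2, y3, modeFn]
    simp; ring
  · simp only [dirac, x0, x1, x2, x3, y0, y1, y2, y3, modeFn]
    simp; ring
  · simp only [dirac, x0, x1, x2, x3, y0, y1, y2, y3, modeFn]
    simp; ring

/-- A test function that coincides with `modeFn` in a neighbourhood of the strip. -/
def testMode (L κ : ℝ) (a b : ℝ → ℂ) (p : ℝ × ℝ) : Spinor := plateau (L + 1) p.2 • modeFn κ a b p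

theorem testMode_eq {L κ : ℝ} {a b : ℝ → ℂ} {p : ℝ × ℝ} (h1 : -L ≤ p.2) (h2 : p.2 ≤ L + 1) :
    testMode L κ a b p = modeFn κ a b p := by
  rw [testMode, plateau_eq_one (by linarith) h2, one_smul]

theorem isTest_testMode {L : ℝ} (hL : 0 < L) {κ : ℝ} (hκ : IsTransverse L κ) {a b : ℝ → ℂ}
    (ha : ContDiff ℝ ∞ a) (hb : ContDiff ℝ ∞ b) (hac : HasCompactSupport a) (hbc : HasCompactSupport b) :
    IsTest L (testMode L κ a b) := by
  refine ⟨((contDiff_plateau (L + 1)).comp contDiff_snd).smul (contDiff_modeFn κ ha hb), ?_, fun x => ?_⟩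
  · have hK := (hac.isCompact.union hbc.isCompact).prod
      (hasCompactSupport_plateau (T := L + 1) (by linarith)).isCompact
    refine HasCompactSupport.intro hK fun p hp => ?_
    rw [Set.mem_prod, not_and_or, Set.mem_union, not_or] at hp
    rcases hp with ⟨h1, h2⟩ | h
    · have h1 := image_eq_zero_of_notMem_tsupport h1
      have h2 := image_eq_zero_of_notMem_tsupport h2
      rw [testMode]
      convert smul_zero _
      ext i
      fin_cases i <;> simp [modeFn, h1, h2]
    · rw [testMode, image_eq_zero_of_notMem_tsupport h, zero_smul]
  · have hph : Complex.exp (-(2 * Real.pi * L * Complex.I)) * Complex.exp (Complex.I * κ * L) =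
        Complex.exp (-(Complex.I * κ * L)) := by
      obtain ⟨j, rfl⟩ := hκ
      rw [← Complex.exp_add, Complex.exp_eq_exp_iff_exists_int]
      refine ⟨j, ?_⟩
      have : (L : ℂ) ≠ 0 := by exact_mod_cast hL.ne'
      push_cast
      field_simp
      ring
    rw [testMode_eq (by simp; linarith) (by simp; linarith), testMode_eq (by simp; linarith) (by simp)]
    refine ⟨?_, ?_, ?_, ?_⟩
    · simp only [modeFn]
      simp
      linear_combination a x * Complex.I_sq
    · simp only [modeFn]
      simp
    · simp only [modeFn]
      simp
      linear_combination a x * hph + a x * Complex.exp (-(Complex.I * κ * L)) * Complex.I_sq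
    · simp only [modeFn]
      simp
      linear_combination - Complex.I * b x * hph

theorem dirac_testMode {L : ℝ} (hL : 0 < L) {κ : ℝ} {a b : ℝ → ℂ} (ha : ContDiff ℝ 1 a)
    (hb : ContDiff ℝ 1 b) {p : ℝ × ℝ} (hp : p ∈ strip L) :
    dirac (testMode L κ a b) p = modeFn κ (fun x => Complex.I * (deriv b x + κ * b x))
      (fun x => Complex.I * (deriv a x - κ * a x)) p := by
  rw [← dirac_modeFn κ ha hb]
  have h : testMode L κ a b =ᶠ[𝓝 p] modeFn κ a b := by
    have : {q : ℝ × ℝ | q.2 ∈ Set.Ioo (-L) (L + 1)} ∈ 𝓝 p :=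
      continuous_snd.continuousAt.preimage_mem_nhds
        (Ioo_mem_nhds (by linarith [hp.1]) (by linarith [hp.2]))
    filter_upwards [this] with q hq
    exact testMode_eq hq.1.le hq.2.le
  simp only [dirac, partialX, partialY, h.fderiv_eq]

/-! ### Fibre integrals and density of the ranges of `𝒟 ± i` -/

/-- Cauchy–Schwarz against the constant 1, read off from `∫ (V‖g‖ - m)² ≥ 0`. -/
theorem sq_norm_integral_le {Y : Type*} [MeasurableSpace Y] {ν : Measure Y} [IsFiniteMeasure ν]
    {g : Y → ℂ} (hg : MemLp g 2 ν) : ‖∫ y, g y ∂ν‖ ^ 2 ≤ ν.real Set.univ * ∫ y, ‖g y‖ ^ 2 ∂ν := by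
  have hi : Integrable g ν := hg.integrable (by norm_num)
  have hi2 : Integrable (fun y => ‖g y‖ ^ 2) ν := (memLp_two_iff_integrable_sq_norm hg.1).1 hg
  set m := ∫ y, ‖g y‖ ∂ν
  set V := ν.real Set.univ
  have h1 : ‖∫ y, g y ∂ν‖ ≤ m := norm_integral_le_integral_norm _
  have h2 : 0 ≤ ∫ y, (V * ‖g y‖ - m) ^ 2 ∂ν := integral_nonneg fun y => sq_nonneg _
  have h3 : ∫ y, (V * ‖g y‖ - m) ^ 2 ∂ν = V * (V * ∫ y, ‖g y‖ ^ 2 ∂ν - m ^ 2) := by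
    have : ∀ y, (V * ‖g y‖ - m) ^ 2 = V ^ 2 * ‖g y‖ ^ 2 - (2 * V * m) * ‖g y‖ + m ^ 2 := fun y => by ring
    simp_rw [this]
    have hsub : Integrable (fun y => V ^ 2 * ‖g y‖ ^ 2 - (2 * V * m) * ‖g y‖) ν :=
      (hi2.const_mul _).sub (hi.norm.const_mul _)
    rw [integral_add hsub (integrable_const _),
      integral_sub (hi2.const_mul _) (hi.norm.const_mul _), integral_const_mul, integral_const_mul,
      integral_const, smul_eq_mul]
    change V ^ 2 * _ - 2 * V * m * m + V * m ^ 2 = _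
    ring
  have hV : 0 ≤ V := measureReal_nonneg
  rcases hV.eq_or_lt with hV0 | hV0
  · have : ν = 0 := by
      have : ν.real Set.univ = 0 := hV0.symm
      rwa [measureReal_def, ENNReal.toReal_eq_zero_iff, or_iff_left (measure_ne_top ν _),
        Measure.measure_univ_eq_zero] at this
    simp [this]
  · have h4 : 0 ≤ V * ∫ y, ‖g y‖ ^ 2 ∂ν - m ^ 2 := by
      rw [h3] at h2
      exact nonneg_of_mul_nonneg_right h2 hV0
    have : ‖∫ y, g y ∂ν‖ ^ 2 ≤ m ^ 2 := by gcongr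
    linarith

/-- The cross-section has finite measure, so transverse coefficients of a square integrable field
are square integrable in `x`, as the uniqueness result on the line requires. -/
theorem memLp_two_integral_prod {X Y : Type*} [MeasurableSpace X] [MeasurableSpace Y] {μ : Measure X}
    {ν : Measure Y} [SFinite μ] [IsFiniteMeasure ν] {f : X × Y → ℂ} (hf : MemLp f 2 (μ.prod ν)) :
    (∀ᵐ x ∂μ, MemLp (fun y => f (x, y)) 2 ν) ∧ MemLp (fun x => ∫ y, f (x, y) ∂ν) 2 μ := by
  have hi2 : Integrable (fun p => ‖f p‖ ^ 2) (μ.prod ν) := (memLp_two_iff_integrable_sq_norm hf.1).1 hf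
  have hsec : ∀ᵐ x ∂μ, MemLp (fun y => f (x, y)) 2 ν := by
    filter_upwards [hi2.prod_right_ae, hf.1.prodMk_left] with x hx hx'
    exact (memLp_two_iff_integrable_sq_norm hx').2 hx
  have hm : AEStronglyMeasurable (fun x => ∫ y, f (x, y) ∂ν) μ := hf.1.integral_prod_right'
  refine ⟨hsec, (memLp_two_iff_integrable_sq_norm hm).2 ?_⟩
  refine (hi2.integral_prod_left.const_mul (ν.real Set.univ)).mono (hm.norm.pow 2) ?_
  filter_upwards [hsec] with x hx
  rw [Real.norm_of_nonneg (by positivity), Real.norm_of_nonneg]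
  · exact sq_norm_integral_le hx
  · exact mul_nonneg measureReal_nonneg (integral_nonneg fun y => by positivity)

theorem norm_exp_I_mul_mul (κ y : ℝ) : ‖Complex.exp (Complex.I * κ * y)‖ = 1 := by
  rw [show Complex.I * κ * y = ((κ * y : ℝ) : ℂ) * Complex.I by push_cast; ring,
    Complex.norm_exp_ofReal_mul_I]

theorem norm_exp_neg_I_mul_mul (κ y : ℝ) : ‖Complex.exp (-(Complex.I * κ * y))‖ = 1 := by
  rw [Complex.exp_neg, norm_inv, norm_exp_I_mul_mul, inv_one]

/-- For each `κ` the transverse coefficient is a weak solution of `h'' = (κ² + 1)h` on the line and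
vanishes; completeness on almost every cross-section then gives the claim. -/
theorem ae_eq_zero_of_modes {L : ℝ} (hL : 0 < L) {f g : ℝ × ℝ → ℂ} (hf : MemLp f 2 (stripMeasure L))
    (hg : MemLp g 2 (stripMeasure L))
    (H : ∀ κ : ℝ, IsTransverse L κ → ∀ ψ : ℝ → ℂ, ContDiff ℝ ∞ ψ → HasCompactSupport ψ →
      ∫ p, (f p * Complex.exp (-(Complex.I * κ * p.2)) + Complex.I * (g p * Complex.exp (Complex.I * κ * p.2))) *
        starRingEnd ℂ (((κ ^ 2 + 1 : ℝ) : ℂ) * ψ p.1 - deriv (deriv ψ) p.1) ∂(stripMeasure L) = 0) :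
    (∀ᵐ p ∂(stripMeasure L), f p = 0) ∧ ∀ᵐ p ∂(stripMeasure L), g p = 0 := by
  rw [stripMeasure_eq_prod] at hf hg H ⊢
  set ν := volume.restrict (Set.Ioo 0 L)
  let G : ℝ → ℝ × ℝ → ℂ := fun κ p =>
    f p * Complex.exp (-(Complex.I * κ * p.2)) + Complex.I * (g p * Complex.exp (Complex.I * κ * p.2))
  have hG (κ : ℝ) : MemLp (G κ) 2 (volume.prod ν) := by
    refine MemLp.add ?_ (MemLp.const_mul ?_ _)
    · exact memLp_of_norm_eq hf (hf.1.mul (Continuous.aestronglyMeasurable (by fun_prop))) fun x => by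
        rw [norm_mul, norm_exp_neg_I_mul_mul, mul_one]
    · exact memLp_of_norm_eq hg (hg.1.mul (Continuous.aestronglyMeasurable (by fun_prop))) fun x => by
        rw [norm_mul, norm_exp_I_mul_mul, mul_one]
  have hzero (κ : ℝ) (hκ : IsTransverse L κ) : ∀ᵐ x : ℝ, ∫ y, G κ (x, y) ∂ν = 0 := by
    refine ae_eq_zero_of_weak_deriv_deriv_eq (m := κ ^ 2 + 1) (by positivity)
      (memLp_two_integral_prod (hG κ)).2 fun ψ hψ hψc => ?_
    have hψd := (contDiff_infty_iff_deriv.1 hψ).2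
    have hψdd := (contDiff_infty_iff_deriv.1 hψd).2
    set F : ℝ → ℂ := fun x => starRingEnd ℂ (((κ ^ 2 + 1 : ℝ) : ℂ) * ψ x - deriv (deriv ψ) x) with hF
    have hFc : Continuous F := by
      have h0 := hψ.continuous
      have h2 := hψdd.continuous
      exact Complex.continuous_conj.comp (by fun_prop)
    have hFs : HasCompactSupport F := by
      have : HasCompactSupport fun x => ((κ ^ 2 + 1 : ℝ) : ℂ) * ψ x - deriv (deriv ψ) x :=
        hψc.mul_left.sub hψc.deriv.deriv
      exact this.comp_left (g := starRingEnd ℂ) (map_zero _)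
    have hFm : MemLp (fun p : ℝ × ℝ => F p.1) 2 (volume.prod ν) :=
      (hFc.memLp_of_hasCompactSupport hFs).comp_fst ν
    have hint : Integrable (fun p : ℝ × ℝ => G κ p * F p.1) (volume.prod ν) := (hG κ).integrable_mul hFm
    have := H κ hκ ψ hψ hψc
    rw [integral_prod _ hint] at this
    rw [← this]
    refine integral_congr_ae (ae_of_all _ fun x => ?_)
    exact (integral_mul_const (F x) fun y => G κ (x, y)).symm
  -- There are countably many transverse wave numbers, so one null set of `x` serves for all of
  -- them.
  have hall : ∀ᵐ x : ℝ, ∀ j : ℤ, ∫ y, G (Real.pi + Real.pi * j / L) (x, y) ∂ν = 0 :=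
    ae_all_iff.2 fun j => hzero _ ⟨j, rfl⟩
  have hsec : ∀ᵐ x : ℝ, (∀ᵐ y ∂ν, f (x, y) = 0) ∧ ∀ᵐ y ∂ν, g (x, y) = 0 := by
    filter_upwards [hall, (memLp_two_integral_prod hf).1, (memLp_two_integral_prod hg).1] with x hx h1 h2
    exact ae_eq_zero_of_transverse_coefficients hL h1 h2 hx
  have hfin {k : ℝ × ℝ → ℂ} (hk : MemLp k 2 (volume.prod ν)) (hk' : ∀ᵐ x : ℝ, ∀ᵐ y ∂ν, k (x, y) = 0) :
      ∀ᵐ p ∂(volume.prod ν), k p = 0 := by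
    have hi2 : Integrable (fun p => ‖k p‖ ^ 2) (volume.prod ν) :=
      (memLp_two_iff_integrable_sq_norm hk.1).1 hk
    have : ∫ p, ‖k p‖ ^ 2 ∂(volume.prod ν) = 0 := by
      rw [integral_prod _ hi2]
      refine integral_eq_zero_of_ae ?_
      filter_upwards [hk'] with x hx
      refine integral_eq_zero_of_ae ?_
      filter_upwards [hx] with y hy
      simp [hy]
    rw [integral_eq_zero_iff_of_nonneg (fun p => by positivity) hi2] at this
    filter_upwards [this] with p hp
    simpa using hp
  exact ⟨hfin hf (hsec.mono fun x h => h.1), hfin hg (hsec.mono fun x h => h.2)⟩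

/-- The ranges of `𝒟 + c`, `c = ± i`, on test functions have trivial orthogonal complement. -/
theorem ae_eq_zero_of_orthogonal_range {L : ℝ} (hL : 0 < L) {w : ℝ × ℝ → Spinor}
    (hw : MemLp w 2 (stripMeasure L)) {c : ℂ} (hc : c ^ 2 = -1)
    (H : ∀ φ, IsTest L φ → ∫ p, pairing (w p) (dirac φ p + c • φ p) ∂(stripMeasure L) = 0) :
    ∀ᵐ p ∂(stripMeasure L), w p = 0 := by
  have hwi := memLp_pi_iff.1 hw
  have hconj (κ y : ℝ) : starRingEnd ℂ (Complex.exp (Complex.I * κ * y)) =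
      Complex.exp (-(Complex.I * κ * y)) := by
    rw [← Complex.exp_conj]; simp
  have hconj' (κ y : ℝ) : starRingEnd ℂ (Complex.exp (-(Complex.I * κ * y))) =
      Complex.exp (Complex.I * κ * y) := by
    rw [← Complex.exp_conj]; simp
  have hder {ψ : ℝ → ℂ} (hψ : ContDiff ℝ ∞ ψ) (x : ℝ) : HasDerivAt ψ (deriv ψ x) x :=
    (hψ.differentiable (by simp) x).hasDerivAt
  obtain ⟨h0, h2⟩ := ae_eq_zero_of_modes hL (hwi 0) (hwi 2) fun κ hκ ψ hψ hψc => by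
    have hψd := (contDiff_infty_iff_deriv.1 hψ).2
    -- The profiles `(-cψ, i(ψ' - κψ))` are those of `(𝒟 - c)` applied to the mode with profiles
    -- `(ψ, 0)`. Applying `𝒟 + c` leaves only `(κ² + 1)ψ - ψ''` in the first profile.
    have hA : ContDiff ℝ ∞ fun x => -c * ψ x := by fun_prop
    have hB : ContDiff ℝ ∞ fun x => Complex.I * (deriv ψ x - κ * ψ x) := by fun_prop
    rw [← H _ (isTest_testMode hL hκ hA hB hψc.mul_left (hψc.deriv.sub hψc.mul_left).mul_left)]
    refine setIntegral_congr_fun (measurableSet_strip L) fun p hp => ?_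
    have dA : deriv (fun x => -c * ψ x) p.1 = -c * deriv ψ p.1 := ((hder hψ p.1).const_mul _).deriv
    have dB : deriv (fun x => Complex.I * (deriv ψ x - κ * ψ x)) p.1 =
        Complex.I * (deriv (deriv ψ) p.1 - κ * deriv ψ p.1) :=
      (((hder hψd p.1).sub ((hder hψ p.1).const_mul _)).const_mul _).deriv
    rw [dirac_testMode hL (hA.of_le (by simp)) (hB.of_le (by simp)) hp,
      testMode_eq (by linarith [hp.1]) (by linarith [hp.2])]
    have e : modeFn κ
          (fun x => Complex.I * (deriv (fun x => Complex.I * (deriv ψ x - κ * ψ x)) x +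
            κ * (Complex.I * (deriv ψ x - κ * ψ x))))
          (fun x => Complex.I * (deriv (fun x => -c * ψ x) x - κ * (-c * ψ x))) p +
        c • modeFn κ (fun x => -c * ψ x) (fun x => Complex.I * (deriv ψ x - κ * ψ x)) p =
        modeFn κ (fun x => ((κ ^ 2 + 1 : ℝ) : ℂ) * ψ x - deriv (deriv ψ) x) 0 p := by
      have e1 : Complex.I * (Complex.I * (deriv (deriv ψ) p.1 - κ * deriv ψ p.1) +
            κ * (Complex.I * (deriv ψ p.1 - κ * ψ p.1))) + c * (-c * ψ p.1) =
          ((κ ^ 2 + 1 : ℝ) : ℂ) * ψ p.1 - deriv (deriv ψ) p.1 := by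
        push_cast
        linear_combination (deriv (deriv ψ) p.1 - κ ^ 2 * ψ p.1) * Complex.I_sq - ψ p.1 * hc
      have e2 : Complex.I * (-c * deriv ψ p.1 - κ * (-c * ψ p.1)) +
          c * (Complex.I * (deriv ψ p.1 - κ * ψ p.1)) = 0 := by ring
      ext i
      fin_cases i
      · simp only [modeFn, dA, dB, ← e1]; simp; ring
      · simp only [modeFn, dA, dB]; simp
        linear_combination Complex.exp (Complex.I * κ * p.2) * e2
      · simp only [modeFn, dA, dB, ← e1]; simp; ring
      · simp only [modeFn, dA, dB]; simp
        linear_combination Complex.I * Complex.exp (-(Complex.I * κ * p.2)) * e2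
    simp only [e]
    simp only [pairing, Fin.sum_univ_four, modeFn]
    simp [hconj, hconj']
    ring
  -- The same with `(𝒟 - c)` applied to the profiles `(0, ψ)`. The last component of a mode carries
  -- `i` where the third has `-i`, hence the sign in front of `w₃`.
  obtain ⟨h1, h3⟩ := ae_eq_zero_of_modes hL (hwi 1) (hwi 3).neg fun κ hκ ψ hψ hψc => by
    have hψd := (contDiff_infty_iff_deriv.1 hψ).2
    have hA : ContDiff ℝ ∞ fun x => Complex.I * (deriv ψ x + κ * ψ x) := by fun_prop
    have hB : ContDiff ℝ ∞ fun x => -c * ψ x := by fun_prop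
    rw [← H _ (isTest_testMode hL hκ hA hB (hψc.deriv.add hψc.mul_left).mul_left hψc.mul_left)]
    refine setIntegral_congr_fun (measurableSet_strip L) fun p hp => ?_
    have dB : deriv (fun x => -c * ψ x) p.1 = -c * deriv ψ p.1 := ((hder hψ p.1).const_mul _).deriv
    have dA : deriv (fun x => Complex.I * (deriv ψ x + κ * ψ x)) p.1 =
        Complex.I * (deriv (deriv ψ) p.1 + κ * deriv ψ p.1) :=
      (((hder hψd p.1).add ((hder hψ p.1).const_mul _)).const_mul _).deriv
    rw [dirac_testMode hL (hA.of_le (by simp)) (hB.of_le (by simp)) hp,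
      testMode_eq (by linarith [hp.1]) (by linarith [hp.2])]
    have e : modeFn κ
          (fun x => Complex.I * (deriv (fun x => -c * ψ x) x + κ * (-c * ψ x)))
          (fun x => Complex.I * (deriv (fun x => Complex.I * (deriv ψ x + κ * ψ x)) x -
            κ * (Complex.I * (deriv ψ x + κ * ψ x)))) p +
        c • modeFn κ (fun x => Complex.I * (deriv ψ x + κ * ψ x)) (fun x => -c * ψ x) p =
        modeFn κ 0 (fun x => ((κ ^ 2 + 1 : ℝ) : ℂ) * ψ x - deriv (deriv ψ) x) p := by
      have e1 : Complex.I * (Complex.I * (deriv (deriv ψ) p.1 + κ * deriv ψ p.1) -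
            κ * (Complex.I * (deriv ψ p.1 + κ * ψ p.1))) + c * (-c * ψ p.1) =
          ((κ ^ 2 + 1 : ℝ) : ℂ) * ψ p.1 - deriv (deriv ψ) p.1 := by
        push_cast
        linear_combination (deriv (deriv ψ) p.1 - κ ^ 2 * ψ p.1) * Complex.I_sq - ψ p.1 * hc
      have e2 : Complex.I * (-c * deriv ψ p.1 + κ * (-c * ψ p.1)) +
          c * (Complex.I * (deriv ψ p.1 + κ * ψ p.1)) = 0 := by ring
      ext i
      fin_cases i
      · simp only [modeFn, dA, dB]; simp
        linear_combination Complex.exp (Complex.I * κ * p.2) * e2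
      · simp only [modeFn, dA, dB, ← e1]; simp; ring
      · simp only [modeFn, dA, dB]; simp
        linear_combination -Complex.I * Complex.exp (-(Complex.I * κ * p.2)) * e2
      · simp only [modeFn, dA, dB, ← e1]; simp; ring
    simp only [e]
    simp only [pairing, Fin.sum_univ_four, modeFn]
    simp [hconj, hconj']
    ring
  filter_upwards [h0, h1, h2, h3] with p p0 p1 p2 p3
  ext i
  fin_cases i
  · exact p0
  · exact p1
  · exact p2
  · simpa using p3

/-! ### Green's formula for weak solutions -/

theorem conj_pairing (a b : Spinor) : starRingEnd ℂ (pairing a b) = pairing b a := by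
  simp [pairing, mul_comm]

theorem integrable_pairing {X : Type*} [MeasurableSpace X] {μ : Measure X} {w v : X → Spinor}
    (hw : MemLp w 2 μ) (hv : MemLp v 2 μ) : Integrable (fun p => pairing (w p) (v p)) μ := by
  refine integrable_finsetSum _ fun i _ => ?_
  have h2 : MemLp (fun p => starRingEnd ℂ (v p i)) 2 μ :=
    memLp_of_norm_eq (memLp_pi_iff.1 hv i)
      (Complex.continuous_conj.comp_aestronglyMeasurable (memLp_pi_iff.1 hv i).1)
      fun x => RCLike.norm_conj _
  exact (memLp_pi_iff.1 hw i).integrable_mul h2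

/-- The Hilbert space of square integrable spinors. -/
abbrev L2Spinor (L : ℝ) : Type := Lp (EuclideanSpace ℂ (Fin 4)) 2 (stripMeasure L)

theorem memLp_toLp {L : ℝ} {w : ℝ × ℝ → Spinor} (hw : MemLp w 2 (stripMeasure L)) :
    MemLp (fun p => (WithLp.toLp 2 (w p) : EuclideanSpace ℂ (Fin 4))) 2 (stripMeasure L) :=
  memLp_piLp_iff.2 fun i => memLp_pi_iff.1 hw i

/-- The arguments change places: `inner` is conjugate-linear in the first one, `pairing` in the
second. -/
theorem inner_eq_integral_pairing {L : ℝ} {f g : L2Spinor L} {w v : ℝ × ℝ → Spinor}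
    (hf : ∀ᵐ p ∂(stripMeasure L), f p = WithLp.toLp 2 (w p))
    (hg : ∀ᵐ p ∂(stripMeasure L), g p = WithLp.toLp 2 (v p)) :
    inner ℂ f g = ∫ p, pairing (v p) (w p) ∂(stripMeasure L) := by
  rw [L2.inner_def]
  refine integral_congr_ae ?_
  filter_upwards [hf, hg] with p h1 h2
  rw [h1, h2]
  simp [PiLp.inner_apply, pairing]

theorem integral_pairing_symm {X : Type*} [MeasurableSpace X] {μ : Measure X} (w v : X → Spinor) :
    ∫ p, pairing (v p) (w p) ∂μ = starRingEnd ℂ (∫ p, pairing (w p) (v p) ∂μ) := by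
  rw [← integral_conj]
  simp_rw [conj_pairing]

theorem dirac_add {φ ψ : ℝ × ℝ → Spinor} (hφ : Differentiable ℝ φ) (hψ : Differentiable ℝ ψ) :
    dirac (φ + ψ) = dirac φ + dirac ψ := by
  funext p
  ext i
  fin_cases i <;> simp [dirac, partialX, partialY, fderiv_add (hφ p) (hψ p)] <;> ring

theorem dirac_smul {φ : ℝ × ℝ → Spinor} (hφ : Differentiable ℝ φ) (c : ℂ) :
    dirac (c • φ) = c • dirac φ := by
  funext p
  ext i
  fin_cases i <;> simp [dirac, partialX, partialY, fderiv_const_smul (hφ p) c] <;> ring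

theorem IsTest.add {L : ℝ} {φ ψ : ℝ × ℝ → Spinor} (hφ : IsTest L φ) (hψ : IsTest L ψ) :
    IsTest L (φ + ψ) := by
  refine ⟨hφ.contDiff.add hψ.contDiff, hφ.hasCompactSupport.add hψ.hasCompactSupport, fun x => ?_⟩
  obtain ⟨a1, a2, a3, a4⟩ := hφ.bc x
  obtain ⟨b1, b2, b3, b4⟩ := hψ.bc x
  simp only [Pi.add_apply]
  refine ⟨?_, ?_, ?_, ?_⟩
  · linear_combination a1 + b1
  · linear_combination a2 + b2
  · linear_combination a3 + b3
  · linear_combination a4 + b4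

theorem IsTest.smul {L : ℝ} {φ : ℝ × ℝ → Spinor} (hφ : IsTest L φ) (c : ℂ) : IsTest L (c • φ) := by
  refine ⟨hφ.contDiff.const_smul c, hφ.hasCompactSupport.smul_left (f := fun _ => c), fun x => ?_⟩
  obtain ⟨a1, a2, a3, a4⟩ := hφ.bc x
  simp only [Pi.smul_apply, smul_eq_mul]
  refine ⟨?_, ?_, ?_, ?_⟩
  · linear_combination c * a1
  · linear_combination c * a2
  · linear_combination c * a3
  · linear_combination c * a4

theorem isTest_zero (L : ℝ) : IsTest L 0 :=
  ⟨contDiff_const, HasCompactSupport.zero, fun x => by simp⟩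

theorem memLp_of_continuous {L : ℝ} {φ : ℝ × ℝ → Spinor} (hφ : Continuous φ)
    (hc : HasCompactSupport φ) : MemLp φ 2 (stripMeasure L) :=
  (hφ.memLp_of_hasCompactSupport hc).restrict _

theorem IsTest.memLp {L : ℝ} {φ : ℝ × ℝ → Spinor} (hφ : IsTest L φ) : MemLp φ 2 (stripMeasure L) :=
  memLp_of_continuous hφ.contDiff.continuous hφ.hasCompactSupport

theorem IsTest.memLp_dirac {L : ℝ} {φ : ℝ × ℝ → Spinor} (hφ : IsTest L φ) :
    MemLp (dirac φ) 2 (stripMeasure L) :=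
  memLp_of_continuous (contDiff_dirac hφ.contDiff).continuous (hasCompactSupport_dirac hφ.hasCompactSupport)

/-- The graph of the Dirac operator on test functions. -/
def testGraph (L : ℝ) : Submodule ℂ (L2Spinor L × L2Spinor L) where
  carrier := {q | ∃ φ, IsTest L φ ∧ (∀ᵐ p ∂(stripMeasure L), q.1 p = WithLp.toLp 2 (φ p)) ∧
    ∀ᵐ p ∂(stripMeasure L), q.2 p = WithLp.toLp 2 (dirac φ p)}
  zero_mem' := by
    refine ⟨0, isTest_zero L, ?_, ?_⟩
    · filter_upwards [Lp.coeFn_zero (EuclideanSpace ℂ (Fin 4)) 2 (stripMeasure L)] with p hp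
      simpa using hp
    · filter_upwards [Lp.coeFn_zero (EuclideanSpace ℂ (Fin 4)) 2 (stripMeasure L)] with p hp
      have : dirac 0 p = 0 := by
        ext i
        fin_cases i <;> simp [dirac, partialX, partialY]
      rw [this]
      simpa using hp
  add_mem' := by
    rintro a b ⟨φ, hφ, h1, h2⟩ ⟨ψ, hψ, h3, h4⟩
    refine ⟨φ + ψ, hφ.add hψ, ?_, ?_⟩
    · filter_upwards [h1, h3, Lp.coeFn_add a.1 b.1] with p k1 k3 k
      rw [Prod.fst_add, k, Pi.add_apply, k1, k3]
      rfl
    · filter_upwards [h2, h4, Lp.coeFn_add a.2 b.2] with p k1 k3 k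
      rw [Prod.snd_add, k, Pi.add_apply, k1, k3, dirac_add (hφ.contDiff.differentiable (by simp))
        (hψ.contDiff.differentiable (by simp))]
      rfl
  smul_mem' := by
    rintro c a ⟨φ, hφ, h1, h2⟩
    refine ⟨c • φ, hφ.smul c, ?_, ?_⟩
    · filter_upwards [h1, Lp.coeFn_smul c a.1] with p k1 k
      rw [Prod.smul_fst, k, Pi.smul_apply, k1]
      rfl
    · filter_upwards [h2, Lp.coeFn_smul c a.2] with p k1 k
      rw [Prod.smul_snd, k, Pi.smul_apply, k1, dirac_smul (hφ.contDiff.differentiable (by simp))]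
      rfl

theorem mem_testGraph {L : ℝ} {φ : ℝ × ℝ → Spinor} (hφ : IsTest L φ) :
    ((memLp_toLp hφ.memLp).toLp _, (memLp_toLp hφ.memLp_dirac).toLp _) ∈ testGraph L :=
  ⟨φ, hφ, MemLp.coeFn_toLp (memLp_toLp hφ.memLp), MemLp.coeFn_toLp (memLp_toLp hφ.memLp_dirac)⟩

theorem eq_zero_of_orthogonal_testGraph {L : ℝ} (hL : 0 < L) {c : ℂ} (hc : c ^ 2 = -1) (u : L2Spinor L)
    (hu : ∀ p ∈ testGraph L, inner ℂ u (p.2 + c • p.1) = 0) : u = 0 := by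
  have hm : MemLp (fun p => (WithLp.ofLp (u p) : Spinor)) 2 (stripMeasure L) :=
    memLp_pi_iff.2 fun i => memLp_piLp_iff.1 (Lp.memLp u) i
  have := ae_eq_zero_of_orthogonal_range hL hm hc fun φ hφ => by
    have h1 := hu _ (mem_testGraph hφ)
    rw [inner_eq_integral_pairing (w := fun p => WithLp.ofLp (u p)) (v := fun p => dirac φ p + c • φ p)
      (ae_of_all _ fun p => rfl)] at h1
    · rw [integral_pairing_symm, h1, map_zero]
    · filter_upwards [Lp.coeFn_add ((memLp_toLp hφ.memLp_dirac).toLp _)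
          (c • (memLp_toLp hφ.memLp).toLp _), Lp.coeFn_smul c ((memLp_toLp hφ.memLp).toLp _),
          MemLp.coeFn_toLp (memLp_toLp hφ.memLp), MemLp.coeFn_toLp (memLp_toLp hφ.memLp_dirac)]
        with p k1 k2 k3 k4
      rw [k1, Pi.add_apply, k2, Pi.smul_apply, k3, k4]
      rfl
  rw [Lp.eq_zero_iff_ae_eq_zero]
  filter_upwards [this] with p hp
  exact (WithLp.ofLp_eq_zero 2).1 hp

/-- `WeakDirac` for functions rather than for classes of functions. -/
def WeakDiracFn (L : ℝ) (w f : ℝ × ℝ → Spinor) : Prop :=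
  ∀ φ, IsTest L φ → ∫ p, pairing (w p) (dirac φ p) ∂(stripMeasure L) =
    ∫ p, pairing (f p) (φ p) ∂(stripMeasure L)

theorem WeakDirac.weakDiracFn {L : ℝ} {w f : Field L} (h : WeakDirac L w f) : WeakDiracFn L w f :=
  fun φ hφ => h φ hφ.contDiff hφ.hasCompactSupport hφ.bc

/-- Green's formula for weak solutions: the Dirac operator with the armchair conditions is self-adjoint. -/
theorem integral_pairing_comm_of_weakDiracFn {L : ℝ} (hL : 0 < L) {w g w' g' : ℝ × ℝ → Spinor}
    (hw : MemLp w 2 (stripMeasure L)) (hg : MemLp g 2 (stripMeasure L))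
    (hw' : MemLp w' 2 (stripMeasure L)) (hg' : MemLp g' 2 (stripMeasure L))
    (h : WeakDiracFn L w g) (h' : WeakDiracFn L w' g') :
    ∫ p, pairing (w p) (g' p) ∂(stripMeasure L) = ∫ p, pairing (g p) (w' p) ∂(stripMeasure L) := by
  have hadj {w g : ℝ × ℝ → Spinor} (hw : MemLp w 2 (stripMeasure L)) (hg : MemLp g 2 (stripMeasure L))
      (h : WeakDiracFn L w g) : ∀ p ∈ testGraph L,
      inner ℂ ((memLp_toLp hw).toLp _) p.2 = inner ℂ ((memLp_toLp hg).toLp _) p.1 := by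
    rintro p ⟨φ, hφ, h1, h2⟩
    rw [inner_eq_integral_pairing (MemLp.coeFn_toLp _) h2,
      inner_eq_integral_pairing (MemLp.coeFn_toLp _) h1, integral_pairing_symm, h φ hφ,
      ← integral_pairing_symm]
  have key := inner_eq_of_mem_adjoint (testGraph L) ?_
    (fun u hu => eq_zero_of_orthogonal_testGraph hL Complex.I_sq u hu)
    (fun u hu => eq_zero_of_orthogonal_testGraph hL (c := -Complex.I) (by simp) u fun p hp => by
      rw [neg_smul, ← sub_eq_add_neg]; exact hu p hp)
    (hadj hw hg h) (hadj hw' hg' h')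
  · rw [inner_eq_integral_pairing (MemLp.coeFn_toLp _) (MemLp.coeFn_toLp _),
      inner_eq_integral_pairing (MemLp.coeFn_toLp _) (MemLp.coeFn_toLp _)] at key
    rw [integral_pairing_symm, key, ← integral_pairing_symm]
  · rintro p ⟨φ, hφ, h1, h2⟩ q ⟨ψ, hψ, h3, h4⟩
    rw [inner_eq_integral_pairing h1 h4, inner_eq_integral_pairing h2 h3,
      integral_pairing_symm, integral_pairing_dirac_comm hL hφ hψ, ← integral_pairing_symm]

/-! ### Cutoffs, weights and conservation of the current -/

/-- The symbol of `𝒟` in the direction of `x`. -/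
def symbolX (a : Spinor) : Spinor :=
  ![Complex.I * a 1, Complex.I * a 0, -Complex.I * a 3, -Complex.I * a 2]

theorem pairing_symbolX (a b : Spinor) : pairing a (symbolX b) = -pairing (symbolX a) b := by
  simp [pairing, symbolX, Fin.sum_univ_four]
  ring

theorem norm_symbolX_le (a : Spinor) : ‖symbolX a‖ ≤ ‖a‖ := by
  refine (pi_norm_le_iff_of_nonneg (norm_nonneg _)).2 fun i => ?_
  fin_cases i <;> simp [symbolX] <;> exact norm_le_pi_norm a _

theorem continuous_symbolX : Continuous symbolX := by
  refine continuous_pi fun i => ?_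
  fin_cases i <;> simp [symbolX] <;> fun_prop

theorem symbolX_add (a b : Spinor) : symbolX (a + b) = symbolX a + symbolX b := by
  ext i; fin_cases i <;> simp [symbolX] <;> ring

theorem pairing_add_left (a b c : Spinor) : pairing (a + b) c = pairing a c + pairing b c := by
  simp [pairing, add_mul, Finset.sum_add_distrib]

theorem pairing_add_right (a b c : Spinor) : pairing a (b + c) = pairing a b + pairing a c := by
  simp [pairing, mul_add, Finset.sum_add_distrib]

theorem pairing_real_smul_left (t : ℝ) (a b : Spinor) : pairing (t • a) b = t * pairing a b := by
  simp [pairing, mul_assoc, Finset.mul_sum]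

theorem pairing_real_smul_right (t : ℝ) (a b : Spinor) : pairing a (t • b) = t * pairing a b := by
  simp [pairing, Finset.mul_sum, mul_left_comm]

theorem dirac_cutoff {φ : ℝ × ℝ → Spinor} {η : ℝ → ℝ} (hφ : Differentiable ℝ φ)
    (hη : Differentiable ℝ η) (p : ℝ × ℝ) :
    dirac (fun p => η p.1 • φ p) p = η p.1 • dirac φ p + deriv η p.1 • symbolX (φ p) := by
  have h1 : HasFDerivAt (fun p : ℝ × ℝ => η p.1)
      ((ContinuousLinearMap.toSpanSingleton ℝ (deriv η p.1)).comp (ContinuousLinearMap.fst ℝ ℝ ℝ)) p :=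
    (hη p.1).hasDerivAt.hasFDerivAt.comp p hasFDerivAt_fst
  have h2 := h1.smul (hφ p).hasFDerivAt
  have hX (i) : partialX (fun p => η p.1 • φ p) p i = η p.1 * partialX φ p i + deriv η p.1 * φ p i := by
    rw [partialX, show (fun p : ℝ × ℝ => η p.1 • φ p) = (fun p : ℝ × ℝ => η p.1) • φ from rfl, h2.fderiv]
    simp [partialX]
  have hY (i) : partialY (fun p => η p.1 • φ p) p i = η p.1 * partialY φ p i := by
    rw [partialY, show (fun p : ℝ × ℝ => η p.1 • φ p) = (fun p : ℝ × ℝ => η p.1) • φ from rfl, h2.fderiv]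
    simp [partialY]
  ext i
  fin_cases i <;> simp [dirac, symbolX, hX, hY] <;> ring

theorem IsTest.cutoff {L : ℝ} {φ : ℝ × ℝ → Spinor} (hφ : IsTest L φ) {η : ℝ → ℝ}
    (hη : ContDiff ℝ ∞ η) : IsTest L fun p => η p.1 • φ p := by
  refine ⟨(hη.comp contDiff_fst).smul hφ.contDiff,
    hφ.hasCompactSupport.smul_left (f := fun p : ℝ × ℝ => η p.1), fun x => ?_⟩
  obtain ⟨a1, a2, a3, a4⟩ := hφ.bc x
  simp only [Pi.smul_apply, Complex.real_smul]
  refine ⟨?_, ?_, ?_, ?_⟩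
  · linear_combination (η x : ℂ) * a1
  · linear_combination (η x : ℂ) * a2
  · linear_combination (η x : ℂ) * a3
  · linear_combination (η x : ℂ) * a4

/-- Square integrability with the weight `e^{σ|x|}`. -/
def WeightedMemLp (L σ : ℝ) (w : ℝ × ℝ → Spinor) : Prop :=
  MemLp (fun p : ℝ × ℝ => Real.exp (σ * |p.1|) • w p) 2 (stripMeasure L)

theorem WeightedMemLp.aestronglyMeasurable {L σ : ℝ} {w : ℝ × ℝ → Spinor} (h : WeightedMemLp L σ w) :
    AEStronglyMeasurable w (stripMeasure L) := by
  have hc : Continuous fun p : ℝ × ℝ => Real.exp (-(σ * |p.1|)) := by fun_prop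
  refine (hc.aestronglyMeasurable.smul h.1).congr (ae_of_all _ fun p => ?_)
  simp [smul_smul, ← Real.exp_add]

theorem WeightedMemLp.of_norm_le {L σ C : ℝ} {w v : ℝ × ℝ → Spinor} (h : WeightedMemLp L σ w)
    (hv : AEStronglyMeasurable v (stripMeasure L)) (hle : ∀ᵐ p ∂(stripMeasure L), ‖v p‖ ≤ C * ‖w p‖) :
    WeightedMemLp L σ v := by
  have hc : Continuous fun p : ℝ × ℝ => Real.exp (σ * |p.1|) := by fun_prop
  refine MemLp.of_le_mul h (hc.aestronglyMeasurable.smul hv) (c := C) ?_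
  filter_upwards [hle] with p hp
  rw [norm_smul, norm_smul]
  nlinarith [norm_nonneg (Real.exp (σ * |p.1|))]

theorem WeightedMemLp.symbolX {L σ : ℝ} {w : ℝ × ℝ → Spinor} (h : WeightedMemLp L σ w) :
    WeightedMemLp L σ fun p => symbolX (w p) :=
  h.of_norm_le (C := 1) (continuous_symbolX.comp_aestronglyMeasurable h.aestronglyMeasurable)
    (ae_of_all _ fun p => by simpa using norm_symbolX_le (w p))

/-- Opposite weights cancel in the product. This is what makes a decaying remainder integrable
against a growing solution. -/
theorem WeightedMemLp.integrable_pairing {L σ : ℝ} {w v : ℝ × ℝ → Spinor} (hw : WeightedMemLp L σ w)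
    (hv : WeightedMemLp L (-σ) v) : Integrable (fun p => pairing (w p) (v p)) (stripMeasure L) := by
  refine (Nanoribbon.integrable_pairing hw hv).congr (ae_of_all _ fun p => ?_)
  simp only [pairing_real_smul_left, pairing_real_smul_right]
  rw [← mul_assoc, ← Complex.ofReal_mul, ← Real.exp_add]
  simp

theorem WeightedMemLp.mono {L σ τ : ℝ} (hτ : τ ≤ σ) {w : ℝ × ℝ → Spinor} (hw : WeightedMemLp L σ w) :
    WeightedMemLp L τ w := by
  have hc : Continuous fun p : ℝ × ℝ => Real.exp (τ * |p.1|) := by fun_prop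
  refine MemLp.mono hw (hc.aestronglyMeasurable.smul hw.aestronglyMeasurable) (ae_of_all _ fun p => ?_)
  rw [norm_smul, norm_smul]
  gcongr
  rw [Real.norm_of_nonneg (Real.exp_nonneg _), Real.norm_of_nonneg (Real.exp_nonneg _)]
  gcongr

theorem weightedMemLp_of_continuous {L σ : ℝ} {φ : ℝ × ℝ → Spinor} (hφ : Continuous φ)
    (hc : HasCompactSupport φ) : WeightedMemLp L σ φ :=
  memLp_of_continuous (by fun_prop) (hc.smul_left (f := fun p : ℝ × ℝ => Real.exp (σ * |p.1|)))

theorem WeightedMemLp.memLp_cutoff {L σ : ℝ} {w : ℝ × ℝ → Spinor} (hw : WeightedMemLp L σ w) {η : ℝ → ℝ}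
    (hη : Continuous η) (hc : HasCompactSupport η) :
    MemLp (fun p => η p.1 • w p) 2 (stripMeasure L) := by
  have h1 : Continuous fun x : ℝ => η x * Real.exp (-(σ * |x|)) := by fun_prop
  obtain ⟨C, hC⟩ := (hc.mul_right (f' := fun x : ℝ => Real.exp (-(σ * |x|)))).exists_bound_of_continuous h1
  refine MemLp.of_le_mul hw ((hη.comp continuous_fst).aestronglyMeasurable.smul hw.aestronglyMeasurable)
    (c := C) (ae_of_all _ fun p => ?_)
  have : η p.1 • w p = (η p.1 * Real.exp (-(σ * |p.1|))) • Real.exp (σ * |p.1|) • w p := by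
    rw [smul_smul, mul_assoc, ← Real.exp_add]
    simp
  rw [this, norm_smul]
  gcongr
  exact hC _

/-- The weak equation is tested with `ηφ`, which still satisfies the boundary conditions because `η`
depends only on `x`. The commutator term changes sides by skewness of `symbolX`. -/
theorem WeakDiracFn.cutoff {L σ : ℝ} {w f : ℝ × ℝ → Spinor} (hw : WeightedMemLp L σ w)
    (hf : WeightedMemLp L σ f) (h : WeakDiracFn L w f) {η : ℝ → ℝ} (hη : ContDiff ℝ ∞ η) :
    WeakDiracFn L (fun p => η p.1 • w p) (fun p => η p.1 • f p + deriv η p.1 • symbolX (w p)) := by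
  intro φ hφ
  have hη' : Continuous (deriv η) := (contDiff_infty_iff_deriv.1 hη).2.continuous
  have hcut {v : ℝ × ℝ → Spinor} (hv : WeightedMemLp L σ v) {θ : ℝ → ℝ} (hθ : Continuous θ)
      {ψ : ℝ × ℝ → Spinor} (hψ : Continuous ψ) (hψc : HasCompactSupport ψ) :
      Integrable (fun p => pairing (v p) (θ p.1 • ψ p)) (stripMeasure L) :=
    hv.integrable_pairing (weightedMemLp_of_continuous (by fun_prop)
      (hψc.smul_left (f := fun p : ℝ × ℝ => θ p.1)))
  have i1 := hcut hw hη.continuous (contDiff_dirac hφ.contDiff).continuous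
    (hasCompactSupport_dirac hφ.hasCompactSupport)
  have i2 : Integrable (fun p => pairing (w p) (deriv η p.1 • Nanoribbon.symbolX (φ p)))
      (stripMeasure L) := hcut hw hη' (continuous_symbolX.comp hφ.contDiff.continuous)
    (hφ.hasCompactSupport.comp_left (g := Nanoribbon.symbolX)
      (by ext i; fin_cases i <;> simp [Nanoribbon.symbolX]))
  have i3 := hcut hf hη.continuous hφ.contDiff.continuous hφ.hasCompactSupport
  have key := h _ (hφ.cutoff hη)
  simp only [dirac_cutoff (hφ.contDiff.differentiable (by simp)) (hη.differentiable (by simp)),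
    pairing_add_right] at key
  rw [integral_add i1 i2] at key
  have e : ∀ p, pairing (η p.1 • f p + deriv η p.1 • Nanoribbon.symbolX (w p)) (φ p) =
      pairing (f p) (η p.1 • φ p) - pairing (w p) (deriv η p.1 • Nanoribbon.symbolX (φ p)) := by
    intro p
    simp only [pairing_add_left, pairing_real_smul_left, pairing_real_smul_right, pairing_symbolX]
    ring
  simp_rw [e]
  rw [integral_sub i3 i2, ← key]
  simp only [pairing_real_smul_left, pairing_real_smul_right]
  ring

/-- Conservation of the current through cross-sections of the strip, in an averaged form. -/
theorem integral_deriv_plateau_mul_pairing_eq_zero {L σ : ℝ} (hL : 0 < L) {w f w' f' : ℝ × ℝ → Spinor}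
    (hw : WeightedMemLp L σ w) (hf : WeightedMemLp L σ f) (hw' : WeightedMemLp L σ w')
    (hf' : WeightedMemLp L σ f') (h : WeakDiracFn L w f) (h' : WeakDiracFn L w' f')
    (hff : ∀ᵐ p ∂(stripMeasure L), pairing (f p) (w' p) = pairing (w p) (f' p)) {T : ℝ} (hT : 0 ≤ T) :
    ∫ p, (((deriv (plateau T) p.1 : ℝ) : ℂ)) * pairing (symbolX (w p)) (w' p) ∂(stripMeasure L) = 0 := by
  have hT2 : 0 ≤ T + 2 := by linarith
  have c0 (T : ℝ) : Continuous (plateau T) := (contDiff_plateau T).continuous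
  have c1 (T : ℝ) : Continuous (deriv (plateau T)) :=
    (contDiff_infty_iff_deriv.1 (contDiff_plateau T)).2.continuous
  have s0 {T : ℝ} (hT : 0 ≤ T) := hasCompactSupport_plateau hT
  have s1 {T : ℝ} (hT : 0 ≤ T) := (hasCompactSupport_plateau hT).deriv
  -- The second cutoff is wider, so that it equals 1 on the support of the first and its derivative
  -- drops out. The zeroth-order terms cancel by `hff`, and only the derivative of `plateau T`
  -- survives.
  have key := integral_pairing_comm_of_weakDiracFn hL (hw.memLp_cutoff (c0 T) (s0 hT))
    ((hf.memLp_cutoff (c0 T) (s0 hT)).add (hw.symbolX.memLp_cutoff (c1 T) (s1 hT)))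
    (hw'.memLp_cutoff (c0 (T + 2)) (s0 hT2))
    ((hf'.memLp_cutoff (c0 (T + 2)) (s0 hT2)).add (hw'.symbolX.memLp_cutoff (c1 (T + 2)) (s1 hT2)))
    (h.cutoff hw hf (contDiff_plateau T)) (h'.cutoff hw' hf' (contDiff_plateau (T + 2)))
  rw [eq_comm, ← sub_eq_zero, ← integral_sub] at key
  · rw [← key]
    refine integral_congr_ae ?_
    filter_upwards [hff] with p hp
    have e1 : plateau T p.1 * plateau (T + 2) p.1 = plateau T p.1 ∧
        deriv (plateau T) p.1 * plateau (T + 2) p.1 = deriv (plateau T) p.1 ∧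
        plateau T p.1 * deriv (plateau (T + 2)) p.1 = 0 := by
      simp only [deriv_plateau]
      rcases le_or_gt p.1 (-T) with h1 | h1
      · rw [plateau_eq_zero_left hT h1, deriv_smoothTransition_of_nonpos (by linarith),
          deriv_smoothTransition_of_nonpos (by linarith)]
        simp
      · rcases le_or_gt (T + 1) p.1 with h2 | h2
        · rw [plateau_eq_zero_right hT h2, deriv_smoothTransition_of_one_le (by linarith),
            deriv_smoothTransition_of_one_le (by linarith)]
          simp
        · rw [plateau_eq_one (T := T + 2) (by linarith) (by linarith),
            deriv_smoothTransition_of_one_le (x := p.1 + (T + 2)) (by linarith),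
            deriv_smoothTransition_of_nonpos (x := p.1 - (T + 2)) (by linarith)]
          simp
    obtain ⟨e1, e2, e3⟩ := e1
    have e1' : (plateau T p.1 : ℂ) * plateau (T + 2) p.1 = plateau T p.1 := by exact_mod_cast e1
    have e2' : ((deriv (plateau T) p.1 : ℝ) : ℂ) * plateau (T + 2) p.1 =
        ((deriv (plateau T) p.1 : ℝ) : ℂ) := by exact_mod_cast e2
    have e3' : (plateau T p.1 : ℂ) * ((deriv (plateau (T + 2)) p.1 : ℝ) : ℂ) = 0 := by exact_mod_cast e3
    simp only [Pi.add_apply, pairing_add_left, pairing_add_right, pairing_real_smul_left,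
      pairing_real_smul_right, hp]
    linear_combination -(pairing (symbolX (w p)) (w' p)) * e2' +
      pairing (w p) (symbolX (w' p)) * e3'
  · exact integrable_pairing
      ((hf.memLp_cutoff (c0 T) (s0 hT)).add (hw.symbolX.memLp_cutoff (c1 T) (s1 hT)))
      (hw'.memLp_cutoff (c0 (T + 2)) (s0 hT2))
  · exact integrable_pairing (hw.memLp_cutoff (c0 T) (s0 hT)) ((hf'.memLp_cutoff (c0 (T + 2)) (s0 hT2)).add
      (hw'.symbolX.memLp_cutoff (c1 (T + 2)) (s1 hT2)))

end Nanoribbon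

end

/-! ### The waves and their current matrix -/

noncomputable section

open scoped Topology
open Filter

namespace Nanoribbon

theorem modeFn_add (κ : ℝ) (a b a' b' : ℝ → ℂ) (p : ℝ × ℝ) :
    modeFn κ a b p + modeFn κ a' b' p = modeFn κ (fun x => a x + a' x) (fun x => b x + b' x) p := by
  ext i; fin_cases i <;> simp [modeFn] <;> ring

theorem modeFn_sub (κ : ℝ) (a b a' b' : ℝ → ℂ) (p : ℝ × ℝ) :
    modeFn κ a b p - modeFn κ a' b' p = modeFn κ (fun x => a x - a' x) (fun x => b x - b' x) p := by
  ext i; fin_cases i <;> simp [modeFn] <;> ring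

theorem modeFn_smul (κ : ℝ) (c : ℂ) (a b : ℝ → ℂ) (p : ℝ × ℝ) :
    c • modeFn κ a b p = modeFn κ (fun x => c * a x) (fun x => c * b x) p := by
  ext i; fin_cases i <;> simp [modeFn] <;> ring

theorem modeFn_real_smul (κ c : ℝ) (a b : ℝ → ℂ) (p : ℝ × ℝ) :
    c • modeFn κ a b p = modeFn κ (fun x => c * a x) (fun x => c * b x) p := by
  ext i; fin_cases i <;> simp [modeFn] <;> ring

theorem expWave_eq_modeFn (ω κ : ℝ) (lam : ℂ) (p : ℝ × ℝ) :
    expWave ω κ lam p = modeFn κ (fun x => Complex.exp (Complex.I * lam * x))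
      (fun x => -((lam + Complex.I * κ) / ω) * Complex.exp (Complex.I * lam * x)) p := by
  ext i; fin_cases i <;> simp [modeFn, expWave] <;> ring

theorem thresholdWave1_eq_modeFn (κ : ℝ) (p : ℝ × ℝ) :
    thresholdWave1 κ p = modeFn κ (fun x => x)
      (fun x => x * (-Complex.I * Real.sign κ) + (|κ|⁻¹ : ℝ) * Complex.I) p := by
  ext i
  fin_cases i
  · simp [modeFn, thresholdWave1, thresholdWave0]
  · simp [modeFn, thresholdWave1, thresholdWave0]; ring
  · simp [modeFn, thresholdWave1, thresholdWave0]; ring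
  · simp [modeFn, thresholdWave1, thresholdWave0]
    linear_combination (((|κ| : ℝ) : ℂ)⁻¹ - p.1 * Real.sign κ) *
      Complex.exp (-(Complex.I * κ * p.2)) * (-Complex.I_sq)

/-- `w` consists of a pair of waves in the transverse mode `κ`, normalised with respect to the current. -/
def IsNormalizedPair (L κ : ℝ) (w : Bool → ℝ × ℝ → Spinor) : Prop :=
  ∃ a b : Bool → ℝ → ℂ, (∀ τ, Continuous (a τ)) ∧ (∀ τ, Continuous (b τ)) ∧
    (∀ τ, w τ = modeFn κ (a τ) (b τ)) ∧
    ∀ τ θ x, 2 * L * (b τ x * starRingEnd ℂ (a θ x) + a τ x * starRingEnd ℂ (b θ x)) =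
      if τ = θ then -(sgn τ : ℂ) else 0

theorem isNormalizedPair_oscWave {L ω κ : ℝ} (hL : 0 < L) (hκ : |κ| < ω) :
    IsNormalizedPair L κ (oscWave L ω κ) := by
  have hω : 0 < ω := (abs_nonneg κ).trans_lt hκ
  set lam := Real.sqrt (ω ^ 2 - κ ^ 2) with hlam
  have hlam0 : 0 < lam := Real.sqrt_pos.2 (by nlinarith [sq_abs κ, abs_nonneg κ])
  set N := Real.sqrt ω / (2 * Real.sqrt (L * lam)) with hN
  -- The current of signs `τ`, `θ` contains the factor `-(sgn τ + sgn θ)λ/ω`, the terms `±iκ` having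
  -- cancelled. It vanishes for opposite signs, and `N` normalises it for equal ones.
  have hN2 : N ^ 2 * (4 * L * lam) = ω := by
    rw [hN, div_pow, mul_pow, Real.sq_sqrt hω.le, Real.sq_sqrt (by positivity)]
    field_simp
    norm_num
  have hN2' : (N : ℂ) ^ 2 * (4 * L * lam) = ω := by exact_mod_cast hN2
  have hωc : (ω : ℂ) ≠ 0 := by exact_mod_cast hω.ne'
  refine ⟨fun τ x => N * Complex.exp (Complex.I * ((sgn τ * lam : ℝ) : ℂ) * x),
    fun τ x => N * (-((((sgn τ * lam : ℝ) : ℂ) + Complex.I * κ) / ω) *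
      Complex.exp (Complex.I * ((sgn τ * lam : ℝ) : ℂ) * x)),
    fun τ => by fun_prop, fun τ => by fun_prop, fun τ => ?_, fun τ θ x => ?_⟩
  · funext p
    rw [oscWave, expWave_eq_modeFn, modeFn_real_smul]
  · have hc (t : ℝ) : starRingEnd ℂ (Complex.exp (Complex.I * t * x)) =
        Complex.exp (-(Complex.I * t * x)) := by
      rw [← Complex.exp_conj]; simp
    have hmul (t : ℝ) : Complex.exp (Complex.I * t * x) * Complex.exp (-(Complex.I * t * x)) = 1 := by
      rw [← Complex.exp_add, add_neg_cancel, Complex.exp_zero]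
    simp only [map_mul, map_neg, map_div₀, map_add, Complex.conj_ofReal, Complex.conj_I, hc]
    by_cases h : τ = θ
    · subst h
      rw [if_pos rfl]
      have e := hmul (sgn τ * lam)
      set g := Complex.exp (Complex.I * ((sgn τ * lam : ℝ) : ℂ) * x)
      set g' := Complex.exp (-(Complex.I * ((sgn τ * lam : ℝ) : ℂ) * x))
      push_cast
      field_simp
      linear_combination (-(N : ℂ) ^ 2 * 4 * L * sgn τ * lam) * e - (sgn τ : ℂ) * hN2'
    · rw [if_neg h]
      have hs : sgn θ = -sgn τ := by cases τ <;> cases θ <;> simp_all [sgn]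
      rw [hs]
      push_cast
      ring

/-- Polarisation: each of the two waves carries no current by itself and their mutual current is
`-1/ω`, so the form becomes diagonal, with opposite signs, on their sum and difference. -/
theorem isNormalizedPair_of_even_odd {L ω κ : ℝ} (hL : 0 < L) (hω : 0 < ω) {ae be ao bo : ℝ → ℂ}
    (hae : Continuous ae) (hbe : Continuous be) (hao : Continuous ao) (hbo : Continuous bo)
    (h1 : ∀ x, be x * starRingEnd ℂ (ae x) + ae x * starRingEnd ℂ (be x) = 0)
    (h2 : ∀ x, bo x * starRingEnd ℂ (ao x) + ao x * starRingEnd ℂ (bo x) = 0)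
    (h3 : ∀ x, be x * starRingEnd ℂ (ao x) + ae x * starRingEnd ℂ (bo x) = -(1 / ω : ℂ))
    (h4 : ∀ x, bo x * starRingEnd ℂ (ae x) + ao x * starRingEnd ℂ (be x) = -(1 / ω : ℂ)) :
    IsNormalizedPair L κ fun τ p => (1 / (2 * Real.sqrt (L / ω))) •
      (modeFn κ ae be p + sgn τ • modeFn κ ao bo p) := by
  set M := 1 / (2 * Real.sqrt (L / ω)) with hM
  have hM2 : M ^ 2 * (4 * L) = ω := by
    rw [hM, div_pow, mul_pow, Real.sq_sqrt (by positivity)]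
    field_simp
    norm_num
  have hM2' : (M : ℂ) ^ 2 * (4 * L) = ω := by exact_mod_cast hM2
  have hωc : (ω : ℂ) ≠ 0 := by exact_mod_cast hω.ne'
  refine ⟨fun τ x => M * (ae x + sgn τ * ao x), fun τ x => M * (be x + sgn τ * bo x),
    fun τ => by fun_prop, fun τ => by fun_prop, fun τ => ?_, fun τ θ x => ?_⟩
  · funext p
    simp only [modeFn_real_smul, modeFn_add]
  · simp only [map_mul, map_add, Complex.conj_ofReal]
    have key : 2 * L * (M * (be x + sgn τ * bo x) * (M * (starRingEnd ℂ (ae x) + sgn θ * starRingEnd ℂ (ao x))) +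
        M * (ae x + sgn τ * ao x) * (M * (starRingEnd ℂ (be x) + sgn θ * starRingEnd ℂ (bo x)))) =
        -((sgn τ : ℂ) + sgn θ) / 2 := by
      have e : (M : ℂ) ^ 2 * (4 * L) * (1 / ω) = 1 := by rw [hM2']; field_simp
      linear_combination 2 * L * M ^ 2 * (h1 x + sgn τ * sgn θ * h2 x + sgn θ * h3 x + sgn τ * h4 x) -
        ((sgn τ : ℂ) + sgn θ) / 2 * e
    rw [key]
    cases τ <;> cases θ <;> norm_num [sgn]

theorem isNormalizedPair_artificialWave {L ωN ε κ : ℝ} (hL : 0 < L) (hε : 0 ≤ ε) (hω : 0 < ωN - ε)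
    (hκ : |κ| = ωN) : IsNormalizedPair L κ (artificialWave L ωN ε κ) := by
  have hωc : ((ωN - ε : ℝ) : ℂ) ≠ 0 := by exact_mod_cast hω.ne'
  set ω := ωN - ε with hωdef
  set μ := rateEps ωN ε with hμ
  let a : ℂ → ℝ → ℂ := fun lam x => Complex.exp (Complex.I * lam * x)
  let b : ℂ → ℝ → ℂ := fun lam x => -((lam + Complex.I * κ) / ω) * Complex.exp (Complex.I * lam * x)
  have heven : evenWave ωN ε κ = modeFn κ
      (fun x => (1 / 2 : ℂ) * (a (lamEps ωN ε) x + a (-lamEps ωN ε) x))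
      (fun x => (1 / 2 : ℂ) * (b (lamEps ωN ε) x + b (-lamEps ωN ε) x)) := by
    funext p
    rw [evenWave, expWave_eq_modeFn, expWave_eq_modeFn, modeFn_add, modeFn_smul]
  have hca (lam : ℂ) : Continuous (a lam) := by fun_prop
  have hcb (lam : ℂ) : Continuous (b lam) := by fun_prop
  have hl : lamEps ωN ε = Complex.I * μ := rfl
  -- Since `λ_ε` is imaginary, the longitudinal exponentials are real, and those of `±λ_ε` are
  -- inverse to each other. The nonzero current therefore comes from pairing the growing wave with
  -- the decaying one.
  have hconj (x : ℝ) : starRingEnd ℂ (Complex.exp (Complex.I * (Complex.I * μ) * x)) =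
      Complex.exp (Complex.I * (Complex.I * μ) * x) := by
    rw [← Complex.exp_conj]; simp
  have hconj' (x : ℝ) : starRingEnd ℂ (Complex.exp (Complex.I * (-(Complex.I * μ)) * x)) =
      Complex.exp (Complex.I * (-(Complex.I * μ)) * x) := by
    rw [← Complex.exp_conj]; simp
  have hmul (x : ℝ) : Complex.exp (Complex.I * (Complex.I * μ) * x) *
      Complex.exp (Complex.I * (-(Complex.I * μ)) * x) = 1 := by
    rw [← Complex.exp_add]; convert Complex.exp_zero using 2; ring
  have h2 : starRingEnd ℂ 2 = 2 := Complex.conj_ofNat 2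
  have hart : artificialWave L ωN ε κ = fun τ p => (1 / (2 * Real.sqrt (L / ω))) •
      (evenWave ωN ε κ p + sgn τ • oddWave ωN ε κ p) := rfl
  rw [hart, heven]
  rcases hε.eq_or_lt with h0 | h0
  · have hμ0 : μ = 0 := by rw [hμ, rateEps, ← h0]; simp
    have hωκ : ω = |κ| := by rw [hκ, hωdef, ← h0, sub_zero]
    have hodd : oddWave ωN ε κ = modeFn κ (fun x => Complex.I * x)
        (fun x => Complex.I * (x * (-Complex.I * Real.sign κ) + (|κ|⁻¹ : ℝ) * Complex.I)) := by
      funext p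
      rw [oddWave, if_pos h0.symm, thresholdWave1_eq_modeFn, modeFn_smul]
    rw [hodd]
    -- At the threshold `ω = |κ|`, and `κ ≠ 0` because `ω > 0`.
    have hsign : (κ : ℂ) / ω = Real.sign κ := by
      rw [hωκ]
      have : κ / |κ| = Real.sign κ := by
        rcases lt_trichotomy κ 0 with h | h | h
        · rw [Real.sign_of_neg h, abs_of_neg h, div_neg, div_self h.ne]
        · exact absurd hωκ (by simp [h, hω.ne'])
        · rw [Real.sign_of_pos h, abs_of_pos h, div_self h.ne']
      exact_mod_cast this
    have hinv : ((|κ|⁻¹ : ℝ) : ℂ) = 1 / ω := by rw [hωκ]; simp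
    have ha0 (x : ℝ) : (1 / 2 : ℂ) * (a (lamEps ωN ε) x + a (-lamEps ωN ε) x) = 1 := by
      simp [a, hl, hμ0]; norm_num
    have hb0 (x : ℝ) : (1 / 2 : ℂ) * (b (lamEps ωN ε) x + b (-lamEps ωN ε) x) =
        -(Complex.I * Real.sign κ) := by
      rw [← hsign]
      simp [b, hl, hμ0]; ring
    refine isNormalizedPair_of_even_odd hL hω (by fun_prop) (by fun_prop) (by fun_prop) (by fun_prop)
      ?_ ?_ ?_ ?_ <;> intro x <;>
      simp only [ha0, hb0, hinv, map_mul, map_neg, map_add, map_one, map_div₀, Complex.conj_ofReal,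
        Complex.conj_I]
    · ring
    · ring
    · linear_combination ((1 / ω : ℂ)) * Complex.I_sq
    · linear_combination ((1 / ω : ℂ)) * Complex.I_sq
  · have hμ0 : (μ : ℂ) ≠ 0 := by
      have : 0 < μ := mul_pos (Real.sqrt_pos.2 h0) (Real.sqrt_pos.2 (by linarith))
      exact_mod_cast this.ne'
    have hodd : oddWave ωN ε κ = modeFn κ
        (fun x => (1 / (2 * lamEps ωN ε)) * (a (lamEps ωN ε) x - a (-lamEps ωN ε) x))
        (fun x => (1 / (2 * lamEps ωN ε)) * (b (lamEps ωN ε) x - b (-lamEps ωN ε) x)) := by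
      funext p
      rw [oddWave, if_neg h0.ne', expWave_eq_modeFn, expWave_eq_modeFn, modeFn_sub, modeFn_smul]
    rw [hodd]
    refine isNormalizedPair_of_even_odd hL hω (by fun_prop) (by fun_prop) (by fun_prop) (by fun_prop)
      ?_ ?_ ?_ ?_ <;> intro x <;>
      simp only [a, b, hl, map_mul, map_neg, map_add, map_sub, map_one, map_div₀, Complex.conj_ofReal,
        Complex.conj_I, hconj, hconj', h2] <;>
      have e := hmul x <;>
      set g := Complex.exp (Complex.I * (Complex.I * μ) * x) <;>
      set g' := Complex.exp (Complex.I * (-(Complex.I * μ)) * x) <;>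
      field_simp
    · ring
    · ring
    · linear_combination (-4 * (μ : ℂ)) * e
    · linear_combination (-4 * (μ : ℂ)) * e

/-- The bracket of profiles is the quantity fixed in `IsNormalizedPair`. The remaining factor is `2
cos((κ - κ')y)`, whose integral over the cross-section supplies the `2L` there when `κ = κ'`. -/
theorem pairing_symbolX_modeFn (κ κ' : ℝ) (a b a' b' : ℝ → ℂ) (p : ℝ × ℝ) :
    pairing (symbolX (modeFn κ a b p)) (modeFn κ' a' b' p) =
      Complex.I * (b p.1 * starRingEnd ℂ (a' p.1) + a p.1 * starRingEnd ℂ (b' p.1)) *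
        (Complex.exp (Complex.I * ((κ - κ' : ℝ) : ℂ) * p.2) +
          Complex.exp (-(Complex.I * ((κ - κ' : ℝ) : ℂ) * p.2))) := by
  have c1 : starRingEnd ℂ (Complex.exp (Complex.I * κ' * p.2)) =
      Complex.exp (-(Complex.I * κ' * p.2)) := by rw [← Complex.exp_conj]; simp
  have c2 : starRingEnd ℂ (Complex.exp (-(Complex.I * κ' * p.2))) =
      Complex.exp (Complex.I * κ' * p.2) := by rw [← Complex.exp_conj]; simp
  have e1 : Complex.exp (Complex.I * ((κ - κ' : ℝ) : ℂ) * p.2) =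
      Complex.exp (Complex.I * κ * p.2) * Complex.exp (-(Complex.I * κ' * p.2)) := by
    rw [← Complex.exp_add]; congr 1; push_cast; ring
  have e2 : Complex.exp (-(Complex.I * ((κ - κ' : ℝ) : ℂ) * p.2)) =
      Complex.exp (-(Complex.I * κ * p.2)) * Complex.exp (Complex.I * κ' * p.2) := by
    rw [← Complex.exp_add]; congr 1; push_cast; ring
  rw [e1, e2]
  simp only [pairing, symbolX, modeFn, Fin.sum_univ_four]
  simp [c1, c2]
  linear_combination -(Complex.I * Complex.exp (-(Complex.I * κ * p.2)) * Complex.exp (Complex.I * κ' * p.2) *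
    (b p.1 * starRingEnd ℂ (a' p.1) + a p.1 * starRingEnd ℂ (b' p.1))) * Complex.I_sq

/-- For `κ ≠ κ'` the difference is a multiple of `π/L`, so the sine that the integral produces
vanishes at `y = L`. -/
theorem integral_transverse_modes {L : ℝ} (hL : 0 < L) {κ κ' : ℝ} (hκ : IsTransverse L κ)
    (hκ' : IsTransverse L κ') :
    ∫ y in Set.Ioo 0 L, (Complex.exp (Complex.I * ((κ - κ' : ℝ) : ℂ) * y) +
      Complex.exp (-(Complex.I * ((κ - κ' : ℝ) : ℂ) * y))) = if κ = κ' then 2 * (L : ℂ) else 0 := by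
  rw [← integral_Ioc_eq_integral_Ioo, ← intervalIntegral.integral_of_le hL.le]
  split_ifs with h
  · simp [h]
    ring
  · set d : ℝ := κ - κ' with hd
    have hd0 : (d : ℂ) ≠ 0 := by exact_mod_cast sub_ne_zero.2 h
    have hc : Complex.I * (d : ℂ) ≠ 0 := mul_ne_zero Complex.I_ne_zero hd0
    have e1 : ∀ y : ℝ, Complex.exp (-(Complex.I * (d : ℂ) * y)) = Complex.exp ((-(Complex.I * d)) * y) :=
      fun y => by rw [neg_mul]
    simp_rw [e1]
    rw [intervalIntegral.integral_add (Continuous.intervalIntegrable (by fun_prop) _ _)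
      (Continuous.intervalIntegrable (by fun_prop) _ _), integral_exp_mul_complex hc,
      integral_exp_mul_complex (neg_ne_zero.2 hc)]
    have h3 : Complex.exp (Complex.I * d * L) = Complex.exp (-(Complex.I * d) * L) := by
      obtain ⟨j, hj⟩ := hκ
      obtain ⟨j', hj'⟩ := hκ'
      rw [Complex.exp_eq_exp_iff_exists_int]
      refine ⟨j - j', ?_⟩
      have hLc : (L : ℂ) ≠ 0 := by exact_mod_cast hL.ne'
      rw [hd, hj, hj']
      push_cast
      field_simp
      ring
    rw [h3]
    field_simp
    simp

theorem IsNormalizedPair.continuous {L κ : ℝ} {w : Bool → ℝ × ℝ → Spinor} (h : IsNormalizedPair L κ w)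
    (τ : Bool) : Continuous (w τ) := by
  obtain ⟨a, b, ha, hb, hw, -⟩ := h
  rw [hw]
  exact (contDiff_modeFn (n := 0) κ (contDiff_zero.2 (ha τ)) (contDiff_zero.2 (hb τ))).continuous

/-- The current matrix of the waves. -/
theorem integral_pairing_symbolX_wave {L : ℝ} (hL : 0 < L) {ι : Type*} [DecidableEq ι] {κ : ι → ℝ}
    (hκ : ∀ k, IsTransverse L (κ k)) (hinj : Function.Injective κ) {w : ι → Bool → ℝ × ℝ → Spinor}
    (hw : ∀ k, IsNormalizedPair L (κ k) (w k)) (k j : ι × Bool) (x : ℝ) :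
    ∫ y in Set.Ioo 0 L, pairing (symbolX (w k.1 k.2 (x, y))) (w j.1 j.2 (x, y)) =
      if k = j then -Complex.I * sgn k.2 else 0 := by
  obtain ⟨a, b, ha, hb, hab, hflux⟩ := hw k.1
  obtain ⟨a', b', ha', hb', hab', hflux'⟩ := hw j.1
  simp_rw [hab, hab', pairing_symbolX_modeFn]
  rw [integral_const_mul, integral_transverse_modes hL (hκ _) (hκ _)]
  by_cases h1 : k.1 = j.1
  · obtain ⟨k1, k2⟩ := k
    obtain ⟨j1, j2⟩ := j
    obtain rfl : k1 = j1 := h1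
    have key : 2 * L * (b k2 x * starRingEnd ℂ (a' j2 x) + a k2 x * starRingEnd ℂ (b' j2 x)) =
        if k2 = j2 then -(sgn k2 : ℂ) else 0 := by
      -- The profiles were extracted twice from existential statements; evaluation at `y = 0` shows
      -- that they agree.
      have hE (τ : Bool) : a' τ x = a τ x ∧ b' τ x = b τ x := by
        have := congrFun ((hab τ).symm.trans (hab' τ)) (x, 0)
        have h0 := congrFun this 0
        have h1 := congrFun this 1
        simp [modeFn] at h0 h1
        exact ⟨h0.symm, h1.symm⟩
      rw [(hE j2).1, (hE j2).2, hflux]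
    simp only [if_true, Prod.mk.injEq, true_and]
    split_ifs at key ⊢ with h2
    · linear_combination Complex.I * key
    · linear_combination Complex.I * key
  · have h2 : κ k.1 ≠ κ j.1 := fun h => h1 (hinj h)
    have h3 : k ≠ j := fun h => h1 (congrArg Prod.fst h)
    simp [h2, h3]

theorem pairing_symbolX_sum {ι : Type*} [Fintype ι] (c d : ι → ℂ) (w : ι → Spinor) :
    pairing (symbolX (∑ k, c k • w k)) (∑ j, d j • w j) =
      ∑ k, ∑ j, c k * starRingEnd ℂ (d j) * pairing (symbolX (w k)) (w j) := by
  have h (i i' : Fin 4) (t : ℂ) : t * (∑ k, c k • w k) i * starRingEnd ℂ ((∑ j, d j • w j) i') =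
      ∑ k, ∑ j, c k * starRingEnd ℂ (d j) * (t * w k i * starRingEnd ℂ (w j i')) := by
    simp only [Finset.sum_apply, Pi.smul_apply, smul_eq_mul, map_sum, map_mul]
    rw [Finset.mul_sum Finset.univ (fun k => c k * w k i) t, Finset.sum_mul_sum]
    refine Finset.sum_congr rfl fun k _ => Finset.sum_congr rfl fun j _ => ?_
    ring
  have e (x y : Spinor) : pairing (symbolX x) y = Complex.I * x 1 * starRingEnd ℂ (y 0) +
      Complex.I * x 0 * starRingEnd ℂ (y 1) + -Complex.I * x 3 * starRingEnd ℂ (y 2) +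
      -Complex.I * x 2 * starRingEnd ℂ (y 3) := by
    simp [pairing, symbolX, Fin.sum_univ_four]
  simp only [e, h, mul_add, Finset.sum_add_distrib]

/-- The current of linear combinations of waves, averaged over cross-sections on one side. -/
theorem integral_mul_pairing_symbolX_eq {L : ℝ} (hL : 0 < L) {ι : Type*} [Fintype ι] [DecidableEq ι]
    {κ : ι → ℝ} (hκ : ∀ k, IsTransverse L (κ k)) (hinj : Function.Injective κ)
    {w : ι → Bool → ℝ × ℝ → Spinor} (hw : ∀ k, IsNormalizedPair L (κ k) (w k)) {v v' : ℝ × ℝ → Spinor}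
    (hv : Continuous v) (hv' : Continuous v') {θ : ℝ → ℝ} (hθ : Continuous θ) (hθc : HasCompactSupport θ)
    (hθ1 : ∫ x, θ x = 1) {c d : ι × Bool → ℂ}
    (hvc : ∀ p : ℝ × ℝ, θ p.1 ≠ 0 → v p = ∑ k, c k • w k.1 k.2 p)
    (hvd : ∀ p : ℝ × ℝ, θ p.1 ≠ 0 → v' p = ∑ k, d k • w k.1 k.2 p) :
    Integrable (fun p : ℝ × ℝ => (θ p.1 : ℂ) * pairing (symbolX (v p)) (v' p)) (stripMeasure L) ∧
    ∫ p, (θ p.1 : ℂ) * pairing (symbolX (v p)) (v' p) ∂(stripMeasure L) =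
      ∑ k, c k * starRingEnd ℂ (d k) * (-Complex.I * sgn k.2) := by
  have hcont : Continuous fun p => pairing (symbolX (v p)) (v' p) :=
    continuous_pairing (continuous_symbolX.comp hv) hv'
  have hint : Integrable (fun p : ℝ × ℝ => (θ p.1 : ℂ) * pairing (symbolX (v p)) (v' p))
      (stripMeasure L) := by
    have hi : Integrable (fun p : ℝ × ℝ => (θ p.1 : ℂ) * pairing (symbolX (v p)) (v' p))
        (volume.restrict (tsupport θ ×ˢ Set.Icc 0 L)) := by
      have : Continuous fun p : ℝ × ℝ => (θ p.1 : ℂ) * pairing (symbolX (v p)) (v' p) := by fun_prop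
      exact this.continuousOn.integrableOn_compact (hθc.isCompact.prod isCompact_Icc)
    refine IntegrableOn.of_forall_sdiff_eq_zero (s := strip L ∩ (tsupport θ ×ˢ Set.Icc 0 L))
      (IntegrableOn.mono_set hi Set.inter_subset_right) (measurableSet_strip L) fun p hp => ?_
    have : p.1 ∉ tsupport θ := fun h => hp.2 ⟨hp.1, h, hp.1.1.le, hp.1.2.le⟩
    simp [image_eq_zero_of_notMem_tsupport this]
  refine ⟨hint, ?_⟩
  rw [stripMeasure_eq_prod] at hint ⊢
  rw [integral_prod _ hint]
  have hsec (x : ℝ) : ∫ y in Set.Ioo 0 L, (θ x : ℂ) * pairing (symbolX (v (x, y))) (v' (x, y)) =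
      (θ x : ℂ) * ∑ k, c k * starRingEnd ℂ (d k) * (-Complex.I * sgn k.2) := by
    by_cases hx : θ x = 0
    · simp [hx]
    · rw [integral_const_mul]
      congr 1
      simp_rw [hvc (x, _) hx, hvd (x, _) hx, pairing_symbolX_sum]
      have hi (k j : ι × Bool) : Integrable (fun y => c k * starRingEnd ℂ (d j) *
          pairing (symbolX (w k.1 k.2 (x, y))) (w j.1 j.2 (x, y))) (volume.restrict (Set.Ioo 0 L)) := by
        have h1 := (hw k.1).continuous k.2
        have h2 := (hw j.1).continuous j.2
        have : Continuous fun y => c k * starRingEnd ℂ (d j) *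
            pairing (symbolX (w k.1 k.2 (x, y))) (w j.1 j.2 (x, y)) :=
          continuous_const.mul (continuous_pairing (continuous_symbolX.comp (by fun_prop)) (by fun_prop))
        exact (this.continuousOn.integrableOn_compact isCompact_Icc).mono_set Set.Ioo_subset_Icc_self
      rw [integral_finsetSum _ fun k _ => integrable_finsetSum _ fun j _ => hi k j]
      refine Finset.sum_congr rfl fun k _ => ?_
      rw [integral_finsetSum _ fun j _ => hi k j]
      simp_rw [integral_const_mul, integral_pairing_symbolX_wave hL hκ hinj hw]
      simp
  simp_rw [hsec]
  rw [integral_mul_const, integral_complex_ofReal, hθ1]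
  simp

/-! ### Currents at infinity and unitarity -/

theorem integral_deriv_smoothTransition : ∫ x, deriv Real.smoothTransition x = 1 := by
  have h0 : ∫ x in (0 : ℝ)..1, deriv Real.smoothTransition x = 1 := by
    rw [intervalIntegral.integral_deriv_eq_sub]
    · simp
    · exact fun x _ => contDiff_smoothTransition.differentiable (by simp) x
    · exact contDiff_deriv_smoothTransition.continuous.intervalIntegrable _ _
  rw [intervalIntegral.integral_of_le zero_le_one,
    setIntegral_eq_integral_of_forall_compl_eq_zero] at h0
  · exact h0
  · intro x hx
    rw [Set.mem_Ioc, not_and_or, not_lt, not_le] at hx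
    rcases hx with hx | hx
    · exact deriv_smoothTransition_of_nonpos hx
    · exact deriv_smoothTransition_of_one_le hx.le

/-- At each fixed point the derivative of `plateau T` is eventually zero, and it is bounded
uniformly in `T`. -/
theorem tendsto_integral_deriv_plateau_mul {μ : Measure (ℝ × ℝ)} {K : ℝ × ℝ → ℂ} (hK : Integrable K μ) :
    Tendsto (fun T : ℕ => ∫ p, (((deriv (plateau T) p.1 : ℝ) : ℂ)) * K p ∂μ) atTop (𝓝 0) := by
  obtain ⟨C, hC⟩ := exists_bound_deriv_smoothTransition
  rw [← integral_zero (ℝ × ℝ) ℂ (μ := μ)]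
  refine tendsto_integral_of_dominated_convergence (fun p => 2 * C * ‖K p‖) (fun T => ?_)
    (hK.norm.const_mul _) (fun T => ae_of_all _ fun p => ?_) (ae_of_all _ fun p => ?_)
  · have : Continuous (deriv (plateau T)) :=
      (contDiff_infty_iff_deriv.1 (contDiff_plateau T)).2.continuous
    have h2 : Continuous fun p : ℝ × ℝ => ((deriv (plateau T) p.1 : ℝ) : ℂ) := by fun_prop
    exact h2.aestronglyMeasurable.mul hK.1
  · rw [norm_mul, Complex.norm_real, deriv_plateau]
    gcongr
    refine (norm_sub_le _ _).trans ?_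
    rw [two_mul]
    exact add_le_add (hC _) (hC _)
  · refine tendsto_const_nhds.congr' ?_
    filter_upwards [eventually_plateau_eq_one p.1] with T hT
    have := hT.deriv.self_of_nhds
    simp at this
    simp [this]

theorem threshold_nonneg (L : ℝ) (n : ℕ) : 0 ≤ threshold L n := by
  cases n with
  | zero => exact le_rfl
  | succ k =>
    -- This also covers an empty set, whose real infimum is 0 by convention.
    refine Real.sInf_nonneg ?_
    rintro t ⟨⟨κ, -, rfl⟩, -⟩
    exact abs_nonneg κ

theorem exists_bound_of_continuousOn_strip {L R₀ : ℝ} {P : ℝ × ℝ → ℝ}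
    (hP : ContinuousOn P {p | 0 ≤ p.2 ∧ p.2 ≤ L})
    (hPs : ∀ x y : ℝ, 0 ≤ y → y ≤ L → R₀ < |x| → P (x, y) = 0) :
    ∃ M, ∀ p ∈ strip L, |P p| ≤ M := by
  have hK : IsCompact (Set.Icc (-R₀) R₀ ×ˢ Set.Icc 0 L) := isCompact_Icc.prod isCompact_Icc
  obtain ⟨M, hM⟩ := hK.exists_bound_of_continuousOn (hP.mono fun p hp => hp.2)
  refine ⟨max M 0, fun p hp => ?_⟩
  rcases le_or_gt |p.1| R₀ with h | h
  · exact (hM p ⟨abs_le.1 h, hp.1.le, hp.2.le⟩).trans (le_max_left _ _)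
  · have : P p = 0 := hPs p.1 p.2 hp.1.le hp.2.le h
    simp [this]

/-- Two elements of the kernel have the same current through distant cross-sections. -/
theorem integral_deriv_plateau_kerAMinus_eq_zero {L γ ω δ R₀ : ℝ} (hL : 0 < L) {P : ℝ × ℝ → ℝ}
    (hP : ContinuousOn P {p | 0 ≤ p.2 ∧ p.2 ≤ L})
    (hPs : ∀ x y : ℝ, 0 ≤ y → y ≤ L → R₀ < |x| → P (x, y) = 0) {z z' : Field L}
    (hz : z ∈ kerAMinus L γ ω δ P) (hz' : z' ∈ kerAMinus L γ ω δ P) {T : ℝ} (hT : 0 ≤ T) :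
    ∫ p, (((deriv (plateau T) p.1 : ℝ) : ℂ)) * pairing (symbolX (z p)) (z' p) ∂(stripMeasure L) = 0 := by
  obtain ⟨M, hM⟩ := exists_bound_of_continuousOn_strip hP hPs
  -- The right-hand side is `(ω - δ𝒫)z`; it inherits the weight of `z` because `𝒫` is bounded on the
  -- strip.
  have hker {z : Field L} (hz : z ∈ kerAMinus L γ ω δ P) : ∃ f : ℝ × ℝ → Spinor,
      WeightedMemLp L (-γ) z ∧ WeightedMemLp L (-γ) f ∧ WeakDiracFn L z f ∧
      ∀ᵐ p ∂(stripMeasure L), f p = (ω - δ * P p) • z p := by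
    obtain ⟨⟨hz1, -⟩, f, hf, hfe⟩ := hz
    have hfe' : ∀ᵐ p ∂(stripMeasure L), f p = (ω - δ * P p) • z p := by
      filter_upwards [hfe] with p hp
      rw [sub_smul, eq_sub_iff_add_eq, ← sub_eq_zero]
      exact hp
    refine ⟨f, hz1, ?_, hf.weakDiracFn, hfe'⟩
    refine WeightedMemLp.of_norm_le (C := |ω| + |δ| * M) hz1 f.aestronglyMeasurable ?_
    filter_upwards [hfe', ae_restrict_mem (measurableSet_strip L)] with p hp hp'
    rw [hp, norm_smul]
    gcongr
    refine (abs_sub _ _).trans ?_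
    rw [abs_mul]
    gcongr
    exact hM p hp'
  obtain ⟨f, h1, h2, h3, h4⟩ := hker hz
  obtain ⟨f', h1', h2', h3', h4'⟩ := hker hz'
  refine integral_deriv_plateau_mul_pairing_eq_zero hL h1 h2 h1' h2' h3 h3' ?_ hT
  filter_upwards [h4, h4'] with p hp hp'
  rw [hp, hp', pairing_real_smul_left, pairing_real_smul_right]

theorem isNormalizedPair_wave {L ε : ℝ} (hL : 0 < L) (hε : 0 ≤ ε) {n : ℕ}
    (hω : threshold L n < threshold L (n + 1) - ε) {κ : Fin (n + 1) → ℝ}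
    (hκ : IsModeFamily L (threshold L (n + 1) - ε) n κ) (k : Fin (n + 1)) :
    IsNormalizedPair L (κ k) (wave L ε n κ k) := by
  have hω0 : 0 < threshold L (n + 1) - ε := (threshold_nonneg L n).trans_lt hω
  by_cases hk : k = Fin.last n
  · have : wave L ε n κ k = artificialWave L (threshold L (n + 1)) ε (κ k) := by
      funext τ; simp [wave, hk]
    rw [this]
    exact isNormalizedPair_artificialWave hL hε hω0 (by rw [hk]; exact hκ.abs_last)
  · have : wave L ε n κ k = oscWave L (threshold L (n + 1) - ε) (κ k) := by
      funext τ; simp [wave, hk]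
    rw [this]
    obtain ⟨j, rfl⟩ := Fin.exists_castSucc_eq.2 hk
    exact isNormalizedPair_oscWave hL (hκ.range_eq.subset ⟨j, rfl⟩).2

theorem IsModeFamily.isTransverse {L ω : ℝ} {n : ℕ} {κ : Fin (n + 1) → ℝ} (hκ : IsModeFamily L ω n κ)
    (k : Fin (n + 1)) : IsTransverse L (κ k) := by
  by_cases hk : k = Fin.last n
  · rw [hk]; exact hκ.isTransverse_last
  · obtain ⟨j, rfl⟩ := Fin.exists_castSucc_eq.2 hk
    exact (hκ.range_eq.subset ⟨j, rfl⟩).1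

/-- The last wave number has modulus `ω_N ≥ ω`, whereas the others lie strictly inside `(-ω, ω)`. -/
theorem IsModeFamily.injective {L ω : ℝ} {n : ℕ} {κ : Fin (n + 1) → ℝ} (hκ : IsModeFamily L ω n κ)
    (hω : ω ≤ threshold L (n + 1)) : Function.Injective κ := by
  have hne (j : Fin n) : κ j.castSucc ≠ κ (Fin.last n) := by
    intro h
    have h1 : |κ j.castSucc| < ω := (hκ.range_eq.subset ⟨j, rfl⟩).2
    rw [h, hκ.abs_last] at h1
    linarith
  intro k j h
  induction k using Fin.lastCases with
  | last =>
    induction j using Fin.lastCases with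
    | last => rfl
    | cast j => exact absurd h.symm (hne j)
  | cast k =>
    induction j using Fin.lastCases with
    | last => exact absurd h (hne k)
    | cast j => rw [hκ.strictMono.injective h]

/-- The augmented scattering matrix is unitary. -/
theorem IsScatteringMatrix.mem_unitaryGroup {L ε γ δ R₀ : ℝ} (hL : 0 < L) (hε : 0 ≤ ε) {n : ℕ}
    (hω : threshold L n < threshold L (n + 1) - ε) {κ : Fin (n + 1) → ℝ}
    (hκ : IsModeFamily L (threshold L (n + 1) - ε) n κ) (hγ : rateEps (threshold L (n + 1)) ε < γ)
    {P : ℝ × ℝ → ℝ} (hPcont : ContinuousOn P {p | 0 ≤ p.2 ∧ p.2 ≤ L})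
    (hPsupp : ∀ x y : ℝ, 0 ≤ y → y ≤ L → R₀ < |x| → P (x, y) = 0)
    {χ : Bool → ℝ → ℝ} (hχ : IsCutoffPair R₀ χ)
    {S : Matrix (Fin (n + 1) × Bool) (Fin (n + 1) × Bool) ℂ}
    (hS : IsScatteringMatrix L γ ε δ P n κ χ S) :
    S ∈ Matrix.unitaryGroup (Fin (n + 1) × Bool) ℂ := by
  obtain ⟨z, r, -, hspan, hr, hzr⟩ := hS
  have hγ0 : 0 ≤ γ := (mul_nonneg (Real.sqrt_nonneg _) (Real.sqrt_nonneg _)).trans hγ.le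
  have hz (a) : z a ∈ kerAMinus L γ (threshold L (n + 1) - ε) δ P := by
    rw [← hspan]; exact Submodule.subset_span ⟨a, rfl⟩
  have hw := isNormalizedPair_wave hL hε hω hκ
  have hinj := hκ.injective (sub_le_self _ hε)
  let v : Fin (n + 1) × Bool → ℝ × ℝ → Spinor := fun a p =>
    inWave L ε n κ χ a.1 a.2 p + ∑ b, S a b • outWave L ε n κ χ b.1 b.2 p
  have hv (a) : Continuous (v a) := by
    have h1 (τ : Bool) : Continuous (χ τ) := (hχ.smooth τ).continuous
    have h2 (b : Fin (n + 1) × Bool) : Continuous (wave L ε n κ b.1 b.2) := (hw b.1).continuous b.2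
    refine Continuous.add ?_ (continuous_finsetSum _ fun b _ => ?_)
    · exact ((h1 _).comp continuous_fst).smul (h2 a)
    · have h3 : Continuous (outWave L ε n κ χ b.1 b.2) := ((h1 _).comp continuous_fst).smul (h2 b)
      exact h3.const_smul (S a b)
  -- Coefficients of `v a` on the side `s`, with `true` for the right. There the wave `b` is
  -- outgoing if `b.2 = s` and enters with `S a b`; otherwise it is incoming and occurs only for `b
  -- = a`.
  let C : Bool → Fin (n + 1) × Bool → Fin (n + 1) × Bool → ℂ := fun s a b =>
    if b.2 = s then S a b else if a = b then 1 else 0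
  have hside (s : Bool) (a) (p : ℝ × ℝ) (hp : ∀ τ, χ τ p.1 = if τ = s then 1 else 0) :
      v a p = ∑ b, C s a b • wave L ε n κ b.1 b.2 p := by
    have h1 : inWave L ε n κ χ a.1 a.2 p =
        ∑ b, (if a = b then if b.2 = s then (0 : ℂ) else 1 else 0) • wave L ε n κ b.1 b.2 p := by
      simp only [inWave, hp, ite_smul, zero_smul, Finset.sum_ite_eq, Finset.mem_univ, if_true, one_smul]
      cases a.2 <;> cases s <;> simp
    simp only [v]
    rw [h1, ← Finset.sum_add_distrib]
    refine Finset.sum_congr rfl fun b _ => ?_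
    simp only [outWave, hp, C]
    by_cases h2 : b.2 = s <;> by_cases h3 : a = b <;> simp [h2, h3]
  let Fl : Bool → Fin (n + 1) × Bool → Fin (n + 1) × Bool → ℂ := fun s a a' =>
    ∑ b, C s a b * starRingEnd ℂ (C s a' b) * (-Complex.I * sgn b.2)
  have hflux (a a') : Fl false a a' - Fl true a a' = 0 := by
    have hzw (a) : WeightedMemLp L (-γ) (z a) := (hz a).1.1
    have hrw (a) : WeightedMemLp L γ (r a) := (hr a).1
    -- The growth of the waves need not be estimated: `v = z - r` almost everywhere, and both terms
    -- have this weight.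
    have hvw (a) : WeightedMemLp L (-γ) (v a) := by
      have hsub : WeightedMemLp L (-γ) (fun p => z a p - r a p) := by
        have := (hzw a).sub ((hrw a).mono (show -γ ≤ γ by linarith))
        refine this.ae_eq (ae_of_all _ fun p => ?_)
        simp [smul_sub]
      refine hsub.of_norm_le (C := 1) (hv a).aestronglyMeasurable ?_
      filter_upwards [hzr a] with p hp
      rw [hp]
      simp [v]
    -- The current of `(z, z')` minus that of `(v, v')`, arranged so that each term contains one
    -- decaying factor.
    let K : ℝ × ℝ → ℂ := fun p =>
      pairing (symbolX (v a p)) (r a' p) + pairing (symbolX (r a p)) (z a' p)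
    have hK : Integrable K (stripMeasure L) :=
      ((hvw a).symbolX.integrable_pairing (by simpa using hrw a')).add
        ((hrw a).symbolX.integrable_pairing (hzw a'))
    -- The left-hand side does not depend on `T`, and the right-hand side tends to zero, so both
    -- vanish.
    have hev : ∀ᶠ T : ℕ in atTop, Fl false a a' - Fl true a a' =
        -∫ p, (((deriv (plateau T) p.1 : ℝ) : ℂ)) * K p ∂(stripMeasure L) := by
      filter_upwards [eventually_ge_atTop ⌈R₀ + 1⌉₊] with T hT
      -- The bumps live on `[-T, 1 - T]` and `[T, T + 1]`. This bound puts the points where they are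
      -- nonzero in `|x| > R₀`, where the cutoffs `χ` are constant.
      have hT' : R₀ + 1 ≤ T := (Nat.le_ceil _).trans (by exact_mod_cast hT)
      let θ : Bool → ℝ → ℝ := fun s x =>
        if s then deriv Real.smoothTransition (x - T) else deriv Real.smoothTransition (x + T)
      have hθ : ∀ s, Continuous (θ s) ∧ HasCompactSupport (θ s) ∧ ∫ x, θ s x = 1 ∧
          ∀ x, θ s x ≠ 0 → ∀ τ, χ τ x = if τ = s then 1 else 0 := by
        have hc := contDiff_deriv_smoothTransition.continuous
        have hcs := hasCompactSupport_deriv_smoothTransition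
        intro s
        cases s
        · refine ⟨?_, ?_, ?_, fun x hx τ => ?_⟩
          · simpa [θ, Function.comp_def] using hc.comp (continuous_add_const (T : ℝ))
          · simpa [θ] using! hcs.comp_homeomorph (Homeomorph.addRight (T : ℝ))
          · simp only [θ, Bool.false_eq_true, if_false]
            rw [integral_add_right_eq_self (deriv Real.smoothTransition), integral_deriv_smoothTransition]
          · have h1 : x + T < 1 := by
              by_contra! h
              exact hx (by simpa [θ] using deriv_smoothTransition_of_one_le h)
            have := hχ.left x (by linarith)
            cases τ <;> simp [this]
        · refine ⟨?_, ?_, ?_, fun x hx τ => ?_⟩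
          · simpa [θ, Function.comp_def] using hc.comp (continuous_sub_right (T : ℝ))
          · simpa [θ] using! hcs.comp_homeomorph (Homeomorph.subRight (T : ℝ))
          · simp only [θ, if_true]
            rw [integral_sub_right_eq_self (deriv Real.smoothTransition), integral_deriv_smoothTransition]
          · have h1 : 0 < x - T := by
              by_contra! h
              exact hx (by simpa [θ] using deriv_smoothTransition_of_nonpos h)
            have := hχ.right x (by linarith)
            cases τ <;> simp [this]
      have hval (s : Bool) := integral_mul_pairing_symbolX_eq hL hκ.isTransverse hinj hw (hv a) (hv a')
        (hθ s).1 (hθ s).2.1 (hθ s).2.2.1 (c := C s a) (d := C s a')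
        (fun p hp => hside s a p ((hθ s).2.2.2 _ hp)) (fun p hp => hside s a' p ((hθ s).2.2.2 _ hp))
      have hzero := integral_deriv_plateau_kerAMinus_eq_zero hL hPcont hPsupp (hz a) (hz a')
        (Nat.cast_nonneg T)
      have hpl (x : ℝ) : deriv (plateau T) x = θ false x - θ true x := by
        rw [deriv_plateau]; simp [θ]
      have hKi : Integrable (fun p => (((deriv (plateau T) p.1 : ℝ) : ℂ)) * K p) (stripMeasure L) := by
        obtain ⟨B, hB⟩ := (hasCompactSupport_plateau (Nat.cast_nonneg T)).deriv.exists_bound_of_continuous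
          (contDiff_infty_iff_deriv.1 (contDiff_plateau T)).2.continuous
        have hc : Continuous fun p : ℝ × ℝ => ((deriv (plateau T) p.1 : ℝ) : ℂ) := by
          have := (contDiff_infty_iff_deriv.1 (contDiff_plateau T)).2.continuous
          fun_prop
        exact hK.bdd_mul hc.aestronglyMeasurable (c := B)
          (ae_of_all _ fun p => by rw [Complex.norm_real]; exact hB _)
      have hsplit : ∫ p, (((deriv (plateau T) p.1 : ℝ) : ℂ)) * pairing (symbolX (z a p)) (z a' p)
          ∂(stripMeasure L) =
          ∫ p, (((θ false p.1 : ℂ) * pairing (symbolX (v a p)) (v a' p) -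
            (θ true p.1 : ℂ) * pairing (symbolX (v a p)) (v a' p)) +
            (((deriv (plateau T) p.1 : ℝ) : ℂ)) * K p) ∂(stripMeasure L) := by
        refine integral_congr_ae ?_
        filter_upwards [hzr a, hzr a'] with p h1 h2
        have h1' : z a p = v a p + r a p := h1
        have h2' : z a' p = v a' p + r a' p := h2
        simp only [K, hpl, h1', h2', symbolX_add, pairing_add_left, pairing_add_right]
        push_cast
        ring
      have hdiff : Integrable (fun p => (θ false p.1 : ℂ) * pairing (symbolX (v a p)) (v a' p) -
            (θ true p.1 : ℂ) * pairing (symbolX (v a p)) (v a' p)) (stripMeasure L) :=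
        (hval false).1.sub (hval true).1
      rw [hsplit, integral_add hdiff hKi, integral_sub (hval false).1 (hval true).1, (hval false).2,
        (hval true).2] at hzero
      exact eq_neg_of_add_eq_zero_left hzero
    have hlim := (tendsto_integral_deriv_plateau_mul hK).neg
    rw [neg_zero] at hlim
    exact tendsto_nhds_unique (tendsto_const_nhds.congr' hev) hlim
  rw [Matrix.mem_unitaryGroup_iff]
  ext a a'
  have key := hflux a a'
  simp only [Fl] at key
  rw [← Finset.sum_sub_distrib] at key
  -- Outgoing waves contribute `+i` and incoming ones `-i` to the left current minus the right one,
  -- whichever side they belong to.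
  have hterm (b : Fin (n + 1) × Bool) :
      C false a b * starRingEnd ℂ (C false a' b) * (-Complex.I * sgn b.2) -
        C true a b * starRingEnd ℂ (C true a' b) * (-Complex.I * sgn b.2) =
      Complex.I * (S a b * starRingEnd ℂ (S a' b) - if a = b then if a' = b then 1 else 0 else 0) := by
    obtain ⟨k, τ⟩ := b
    by_cases h1 : a = (k, τ) <;> by_cases h2 : a' = (k, τ) <;> cases τ <;> simp [C, sgn, h1, h2] <;> ring
  simp_rw [hterm] at key
  rw [← Finset.mul_sum, mul_eq_zero, or_iff_right Complex.I_ne_zero, Finset.sum_sub_distrib,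
    sub_eq_zero] at key
  rw [Matrix.mul_apply]
  simp only [Matrix.star_apply]
  refine key.trans ?_
  simp [Matrix.one_apply, eq_comm]

end Nanoribbon

end

theorem mainTheorem5
    (L : ℝ) (hL : 0 < L) (hL2 : ∀ m : ℕ, 2 * L ≠ m)
    (n : ℕ) (ε : ℝ) (hε : 0 ≤ ε)
    (hω : Nanoribbon.threshold L n < Nanoribbon.threshold L (n + 1) - ε)
    (κ : Fin (n + 1) → ℝ)
    (hκ : Nanoribbon.IsModeFamily L (Nanoribbon.threshold L (n + 1) - ε) n κ)
    (γ : ℝ) (hγ : Nanoribbon.rateEps (Nanoribbon.threshold L (n + 1)) ε < γ)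
    (hγ' : γ < Real.sqrt (Nanoribbon.threshold L (n + 2) ^ 2 -
      (Nanoribbon.threshold L (n + 1) - ε) ^ 2))
    (R₀ : ℝ) (hR₀ : 0 < R₀) (P : ℝ × ℝ → ℝ)
    (hPcont : ContinuousOn P {p | 0 ≤ p.2 ∧ p.2 ≤ L})
    (hPsupp : ∀ x y : ℝ, 0 ≤ y → y ≤ L → R₀ < |x| → P (x, y) = 0)
    (δ : ℝ)
    (χ : Bool → ℝ → ℝ) (hχ : Nanoribbon.IsCutoffPair R₀ χ)
    (S : Matrix (Fin (n + 1) × Bool) (Fin (n + 1) × Bool) ℂ)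
    (hS : Nanoribbon.IsScatteringMatrix L γ ε δ P n κ χ S) :
    S ∈ Matrix.unitaryGroup (Fin (n + 1) × Bool) ℂ := by
  exact hS.mem_unitaryGroup hL hε hω hκ hγ hPcont hPsupp hχ
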